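/- Let $I=(y_L,y_R)$ be a bounded interval and $T>0$. Let $u,\rho,\omega$ be a smooth solution (up to the boundary of $[y_L,y_R]\times[0,T]$) of the coupled dispersionless system $$\rho_s+u\omega=0,\qquad \omega_s=\rho u,\qquad \omega=u_y ,$$ with Dirichlet boundary conditions $u(y_L,s)=g_L(s)$, $u(y_R,s)=g_R(s)$. For a mesh $y_L=y_{1/2}<y_{3/2}<\dots<y_{N+1/2}=y_R$ with cells $I_j=[y_{j-1/2},y_{j+1/2}]$ and mesh size $h=\max_j(y_{j+1/2}-y_{j-1/2})$, let $V_h^k$ be the space of functions whose restriction to each $I_j$ is a polynomial of degree at most $k$, and let $v^-_{j+1/2}$, $v^+_{j+1/2}$ denote the traces of $v\in V_h^k$ at $y_{j+1/2}$ from the left and from the right. The semi-discrete $H_1$-conserved DG scheme seeks $u_h,\rho_h,\omega_h$ with $u_h(\cdot,s),\rho_h(\cdot,s),\omega_h(\cdot,s)\in V_h^k$ such that for all $s\in[0,T]$, all $\varphi,\phi,\psi\in V_h^k$ and all $j$, $$\int_{I_j}(\rho_h)_s\,\phi\,dy+\int_{I_j}u_h\omega_h\,\phi\,dy=0,\qquad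 \int_{I_j}(\omega_h)_s\,\varphi\,dy=\int_{I_j}\rho_hu_h\,\varphi\,dy,$$ $$\int_{I_j}\omega_h\,\psi\,dy=\widehat{u_h}_{,j+1/2}\,\psi^-_{j+1/2}-\widehat{u_h}_{,j-1/2}\,\psi^+_{j-1/2}-\int_{I_j}u_h\,\psi_y\,dy,$$ with the numerical flux $\widehat{u_h}=u_h^+$, where at the right end point $u_h^+(y_{N+1/2},s)$ is the boundary value $g_R(s)$. Then for every $k\ge 0$ and every constant $C_0$ there is a constant $C>0$, depending only on $k$, $C_0$, $I$, $T$ and the exact solution $(u,\rho,\omega)$, such that for every mesh and every solution $(u_h,\rho_h,\omega_h)$ of the scheme on $[0,T]$ whose initial values satisfy $$\|u-u_h\|_{L^2(I)}+\|\omega-\omega_h\|_{L^2(I)}+\|\rho-\rho_h\|_{L^2(I)}\le C_0h^{k+1}\quad\text{at } s=0,$$ one has, for all $s\in[0,T]$, $$\|u-u_h\|_{L^2(I)}+\|\omega-\omega_h\|_{L^2(I)}+\|\rho-\rho_h\|_{L^2(I)}\le C\,h^{k+1}.$$ -/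

import Mathlib

open Set Polynomial

noncomputable section

namespace ShortPulse

/-- `(u, ρ, ω)`, functions of `(y, s)`, is a solution, smooth up to the boundary of
`[yL, yR] × [0, T]`, of the first-order coupled dispersionless system
`ρ_s + u ω = 0`, `ω_s = ρ u`, `ω = u_y`, with Dirichlet boundary conditions
`u(yL, s) = gL(s)`, `u(yR, s) = gR(s)`. -/
structure IsSmoothCDSolution (yL yR T : ℝ) (gL gR : ℝ → ℝ) (u ρ ω : ℝ → ℝ → ℝ) : Prop where
  smooth_u : ContDiffOn ℝ ((⊤ : ℕ∞) : WithTop ℕ∞) (Function.uncurry u) (Icc yL yR ×ˢ Icc 0 T)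
  smooth_ρ : ContDiffOn ℝ ((⊤ : ℕ∞) : WithTop ℕ∞) (Function.uncurry ρ) (Icc yL yR ×ˢ Icc 0 T)
  smooth_ω : ContDiffOn ℝ ((⊤ : ℕ∞) : WithTop ℕ∞) (Function.uncurry ω) (Icc yL yR ×ˢ Icc 0 T)
  eq_ρ : ∀ y ∈ Icc yL yR, ∀ s ∈ Icc 0 T,
    HasDerivWithinAt (fun τ => ρ y τ) (-(u y s * ω y s)) (Icc 0 T) s
  eq_ω : ∀ y ∈ Icc yL yR, ∀ s ∈ Icc 0 T,
    HasDerivWithinAt (fun τ => ω y τ) (ρ y s * u y s) (Icc 0 T) s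
  eq_u : ∀ y ∈ Icc yL yR, ∀ s ∈ Icc 0 T,
    HasDerivWithinAt (fun z => u z s) (ω y s) (Icc yL yR) y
  bdry_left : ∀ s ∈ Icc 0 T, u yL s = gL s
  bdry_right : ∀ s ∈ Icc 0 T, u yR s = gR s

/-- A mesh of `[yL, yR]` with `N` cells: cell `j : Fin N` is
`[node j.castSucc, node j.succ]`. -/
structure Mesh (yL yR : ℝ) where
  N : ℕ
  N_pos : 0 < N
  node : Fin (N + 1) → ℝ
  strictMono_node : StrictMono node
  node_zero : node 0 = yL
  node_last : node (Fin.last N) = yR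

namespace Mesh

variable {yL yR : ℝ} (M : Mesh yL yR)

/-- Left end point of the cell `j`. -/
def left (j : Fin M.N) : ℝ := M.node j.castSucc

/-- Right end point of the cell `j`. -/
def right (j : Fin M.N) : ℝ := M.node j.succ

/-- The mesh size `h`, the maximum of the cell lengths. -/
def size : ℝ := ⨆ j : Fin M.N, (M.right j - M.left j)

/-- Broken polynomials: one polynomial (in the global variable `y`) per cell, so that one-sided
traces at the nodes are evaluations. -/
abbrev Broken : Type := Fin M.N → ℝ[X]

/-- The space `V_h^k` of piecewise polynomials of degree at most `k`. -/
def dgSpace (k : ℕ) : Set M.Broken := {v | ∀ j, (v j).natDegree ≤ k}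

variable {M}

/-- The function on `[yL, yR)` given by a broken polynomial: on the cell `j` it is `v j`. The
value at a node is taken from the cell on its right, and is irrelevant for `L²` norms. -/
def Broken.toFun (v : M.Broken) (y : ℝ) : ℝ :=
  ∑ j, (Ico (M.left j) (M.right j)).indicator (fun z => (v j).eval z) y

/-- The flux `û_h = u_h⁺` at all the nodes: the trace from the cell on the right of the node, and
at the last node `yR`, where there is no such cell, the Dirichlet datum `g`. -/
def fluxPlus (v : M.Broken) (g : ℝ) : Fin (M.N + 1) → ℝ :=
  Fin.snoc (α := fun _ => ℝ) (fun j => (v j).eval (M.left j)) g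

/-- The partial derivative `∂_s v_h(y, s)` of a time-dependent broken polynomial on cell `j`
(one-sided at the ends of `[0, T]`). -/
def timeDeriv (T : ℝ) (v : ℝ → M.Broken) (j : Fin M.N) (y s : ℝ) : ℝ :=
  derivWithin (fun τ => (v τ j).eval y) (Icc 0 T) s

end Mesh

/-- `(u_h, ρ_h, ω_h)` solves on `[0, T]` the semi-discrete `H₁`-conserved DG scheme in `V_h^k` with
flux `û_h = u_h⁺` and the Dirichlet datum `gR` at `yR`. -/
structure IsDGSolution {yL yR : ℝ} (M : Mesh yL yR) (k : ℕ) (T : ℝ) (gR : ℝ → ℝ)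
    (uh ρh ωh : ℝ → M.Broken) : Prop where
  mem_u : ∀ s ∈ Icc 0 T, uh s ∈ M.dgSpace k
  mem_ρ : ∀ s ∈ Icc 0 T, ρh s ∈ M.dgSpace k
  mem_ω : ∀ s ∈ Icc 0 T, ωh s ∈ M.dgSpace k
  diff_ρ : ∀ j y, DifferentiableOn ℝ (fun s => (ρh s j).eval y) (Icc 0 T)
  diff_ω : ∀ j y, DifferentiableOn ℝ (fun s => (ωh s j).eval y) (Icc 0 T)
  eq_ρ : ∀ s ∈ Icc 0 T, ∀ φ ∈ M.dgSpace k, ∀ j,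
    (∫ y in M.left j..M.right j, Mesh.timeDeriv T ρh j y s * (φ j).eval y)
      + (∫ y in M.left j..M.right j, (uh s j).eval y * (ωh s j).eval y * (φ j).eval y) = 0
  eq_ω : ∀ s ∈ Icc 0 T, ∀ φ ∈ M.dgSpace k, ∀ j,
    (∫ y in M.left j..M.right j, Mesh.timeDeriv T ωh j y s * (φ j).eval y)
      = ∫ y in M.left j..M.right j, (ρh s j).eval y * (uh s j).eval y * (φ j).eval y
  eq_u : ∀ s ∈ Icc 0 T, ∀ ψ ∈ M.dgSpace k, ∀ j,
    (∫ y in M.left j..M.right j, (ωh s j).eval y * (ψ j).eval y)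
      = Mesh.fluxPlus (uh s) (gR s) j.succ * (ψ j).eval (M.right j)
        - Mesh.fluxPlus (uh s) (gR s) j.castSucc * (ψ j).eval (M.left j)
        - ∫ y in M.left j..M.right j, (uh s j).eval y * (ψ j).derivative.eval y

/-- The `L²(yL, yR)` norm; used below for piecewise continuous functions only. -/
def l2norm (yL yR : ℝ) (f : ℝ → ℝ) : ℝ := Real.sqrt (∫ y in yL..yR, f y ^ 2)

/-- `‖u - u_h‖ + ‖ω - ω_h‖ + ‖ρ - ρ_h‖` in `L²(yL, yR)` at the time `s`. -/
def totalError {yL yR : ℝ} {M : Mesh yL yR} (u ρ ω : ℝ → ℝ → ℝ) (uh ρh ωh : ℝ → M.Broken)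
    (s : ℝ) : ℝ :=
  l2norm yL yR (fun y => u y s - (uh s).toFun y)
    + l2norm yL yR (fun y => ω y s - (ωh s).toFun y)
    + l2norm yL yR (fun y => ρ y s - (ρh s).toFun y)

end ShortPulse

end

noncomputable section

namespace ShortPulse

/-! ### Polynomials of bounded degree -/

/-! The error of `u_h` is controlled by that of `ω_h`. Testing the third equation with `1` shows
that the flux is a discrete antiderivative of `ω_h` starting from the exact datum at `yR`, so nodal
errors of `u_h` are at most the `L¹` norm of `ω - ω_h`. Inside a cell let `U` be the antiderivative
of `ω_h` that equals the flux at the right end. Integration by parts turns the equation into the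
statement that `u_h` is the Gauss–Radau projection of `U`: same value at the left end, same moments
against polynomials of degree below `k`. This projection is stable in the maximum norm uniformly in
the cell, whence `|u - u_h| ≤ C (h^(k+1) + ‖ω - ω_h‖_{L¹})` pointwise
(`exists_antiderivative_error_bound`).

The scheme conserves `‖ρ_h‖² + ‖ω_h‖²`, because the cubic terms cancel when the evolution equations
are tested with `ρ_h` and `ω_h`. With the previous bound this gives a maximum norm bound for `u_h`,
independent of the mesh and without inverse inequalities, so no mesh regularity is needed.

Finally `‖ρ - ρ_h‖² + ‖ω - ω_h‖²` is differentiated in time. The terms with `u_h (ρ - ρ_h)(ω - ω_h)`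
cancel by skew symmetry, terms with `u - u_h` carry a bounded exact factor, and the residuals of the
discrete equations are orthogonal to `V_h^k`, so they cost only best approximation errors of `ρ`,
`ω`, `uω`, `uρ` and the error itself (`energy_integrand_le`). Gronwall's inequality yields the rate
for `ρ` and `ω`, and the pointwise bound transfers it to `u`. -/

theorem natDegree_le_of_degree_lt {k : ℕ} {p : ℝ[X]} (hp : p.degree < (k + 1 : ℕ)) :
    p.natDegree ≤ k :=
  natDegree_le_iff_degree_le.2 (Order.lt_succ_iff.1 (by exact_mod_cast hp))

/-- A polynomial vanishing at `0` with `k` vanishing moments on `[0, 1]` and degree at most `k`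
is zero. -/
theorem eq_zero_of_moments_eq_zero {k : ℕ} {p : ℝ[X]} (hp : p.natDegree ≤ k)
    (h0 : p.eval 0 = 0) (hm : ∀ i < k, ∫ x in (0 : ℝ)..1, p.eval x * x ^ i = 0) : p = 0 := by
  obtain ⟨r, rfl⟩ : X ∣ p := by
    rw [X_dvd_iff, coeff_zero_eq_eval_zero, h0]
  by_contra hne
  have hr : r ≠ 0 := right_ne_zero_of_mul hne
  have hdeg : r.natDegree < k := by
    rw [natDegree_X_mul hr] at hp
    omega
  -- With `p = X r`, the quotient `r` has degree below `k` and is itself a combination of the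
  -- available test monomials; this gives `∫ x r² = 0` with a nonnegative integrand.
  have hint : ∫ x in (0 : ℝ)..1, (X * r).eval x * r.eval x = 0 := by
    have h1 : ∀ x : ℝ, (X * r).eval x * r.eval x
        = ∑ i ∈ Finset.range k, r.coeff i * ((X * r).eval x * x ^ i) := by
      intro x
      rw [eval_eq_sum_range' hdeg x, Finset.mul_sum]
      exact Finset.sum_congr rfl fun i _ => by ring
    simp_rw [h1]
    rw [intervalIntegral.integral_finsetSum (μ := MeasureTheory.volume)]
    · refine Finset.sum_eq_zero fun i hi => ?_
      rw [intervalIntegral.integral_const_mul, hm i (Finset.mem_range.1 hi), mul_zero]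
    · intro i _
      exact Continuous.intervalIntegrable (by fun_prop) _ _
  have hnn : ∀ x : ℝ, 0 ≤ x → 0 ≤ (X * r).eval x * r.eval x := by
    intro x hx
    simp only [eval_mul, eval_X]
    nlinarith [mul_nonneg hx (mul_self_nonneg (r.eval x))]
  apply hr
  refine eq_zero_of_infinite_isRoot r ((Ioc_infinite (zero_lt_one' ℝ)).mono fun c hc => ?_)
  by_contra hc0
  refine absurd hint (intervalIntegral.integral_pos one_pos (by fun_prop)
    (fun x hx => hnn x hx.1.le) ⟨c, ⟨hc.1.le, hc.2⟩, ?_⟩).ne'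
  have : 0 < r.eval c * r.eval c := mul_self_pos.2 hc0
  simp only [eval_mul, eval_X]
  nlinarith [mul_pos hc.1 this]

/-- A polynomial of degree at most `k` is bounded on `[0, 1]` by its value at `0` and its first `k`
moments. -/
theorem exists_bound_of_moments (k : ℕ) : ∃ C : ℝ, 0 < C ∧ ∀ p : ℝ[X], p.natDegree ≤ k →
    ∀ F : ℝ, |p.eval 0| ≤ F → (∀ i < k, |∫ x in (0 : ℝ)..1, p.eval x * x ^ i| ≤ F) →
    ∀ y ∈ Icc (0 : ℝ) 1, |p.eval y| ≤ C * F := by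
  have hint : ∀ (p : ℝ[X]) (i : ℕ),
      IntervalIntegrable (fun x => p.eval x * x ^ i) MeasureTheory.volume 0 1 := fun p i =>
    (by fun_prop : Continuous fun x : ℝ => p.eval x * x ^ i).intervalIntegrable _ _
  -- The data (value at `0`, moments) form an injective linear map on a finite-dimensional space. A
  -- left inverse followed by the inclusion into `C([0, 1])` is automatically continuous, and its
  -- norm supplies the constant.
  let L : degreeLT ℝ (k + 1) →ₗ[ℝ] ℝ × (Fin k → ℝ) :=
    { toFun := fun p => (p.1.eval 0, fun i => ∫ x in (0 : ℝ)..1, p.1.eval x * x ^ (i : ℕ))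
      map_add' := by
        intro p q
        ext i
        · simp
        · simp only [Submodule.coe_add, eval_add, add_mul, Prod.snd_add, Pi.add_apply]
          rw [intervalIntegral.integral_add (hint _ _) (hint _ _)]
      map_smul' := by
        intro c p
        ext i
        · simp
        · simp only [Submodule.coe_smul, eval_smul, smul_eq_mul, mul_assoc, RingHom.id_apply,
            Prod.smul_snd, Pi.smul_apply]
          rw [intervalIntegral.integral_const_mul] }
  have hker : L.ker = ⊥ := by
    refine LinearMap.ker_eq_bot'.2 fun p hp => Subtype.ext ?_
    have h1 := congrArg Prod.fst hp
    have h2 := fun i => congrFun (congrArg Prod.snd hp) i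
    exact eq_zero_of_moments_eq_zero (natDegree_le_of_degree_lt (mem_degreeLT.1 p.2)) h1
      fun i hi => h2 ⟨i, hi⟩
  obtain ⟨G, hG⟩ := L.exists_leftInverse_of_injective hker
  let S : ℝ × (Fin k → ℝ) →ₗ[ℝ] C(Icc (0 : ℝ) 1, ℝ) :=
    (toContinuousMapOnAlgHom (Icc (0 : ℝ) 1)).toLinearMap ∘ₗ (degreeLT ℝ (k + 1)).subtype ∘ₗ G
  let S' := LinearMap.toContinuousLinearMap S
  refine ⟨‖S'‖ + 1, by positivity, fun p hp F h0 hm y hy => ?_⟩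
  have hF : 0 ≤ F := (abs_nonneg _).trans h0
  have hpm : p ∈ degreeLT ℝ (k + 1) :=
    mem_degreeLT.2 ((natDegree_le_iff_degree_le.1 hp).trans_lt (by exact_mod_cast k.lt_succ_self))
  have hz : ‖L ⟨p, hpm⟩‖ ≤ F := by
    rw [Prod.norm_def, max_le_iff]
    exact ⟨h0, (pi_norm_le_iff_of_nonneg hF).2 fun i => hm i i.2⟩
  have hS : (S' (L ⟨p, hpm⟩)) ⟨y, hy⟩ = p.eval y := by
    have : G (L ⟨p, hpm⟩) = ⟨p, hpm⟩ := LinearMap.congr_fun hG _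
    simp [S', S, this]
  rw [← hS, ← Real.norm_eq_abs]
  calc _ ≤ ‖S' (L ⟨p, hpm⟩)‖ := ContinuousMap.norm_coe_le_norm _ _
    _ ≤ ‖S'‖ * ‖L ⟨p, hpm⟩‖ := S'.le_opNorm _
    _ ≤ (‖S'‖ + 1) * F := by gcongr; linarith

/-- Stability in the maximum norm of the Gauss–Radau projection onto polynomials of degree at
most `k`, uniformly in the interval. -/
theorem exists_radau_bound (k : ℕ) : ∃ K : ℝ, 0 < K ∧ ∀ (a b : ℝ), a < b → ∀ p : ℝ[X],
    p.natDegree ≤ k → ∀ (f : ℝ → ℝ) (F : ℝ), (∀ y ∈ Icc a b, |f y| ≤ F) → p.eval a = f a →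
    (∀ q : ℝ[X], q.natDegree ≤ k → ∫ y in a..b, p.eval y * q.derivative.eval y
      = ∫ y in a..b, f y * q.derivative.eval y) →
    ∀ y ∈ Icc a b, |p.eval y| ≤ K * F := by
  obtain ⟨K, hK, h⟩ := exists_bound_of_moments k
  refine ⟨K, hK, fun a b hab p hp f F hf hpa hpf y hy => ?_⟩
  have hba : 0 < b - a := sub_pos.2 hab
  let P : ℝ[X] := p.comp (C a + C (b - a) * X)
  have hPe : ∀ x, P.eval x = p.eval (a + (b - a) * x) := fun x => by simp [P]
  have hP : P.natDegree ≤ k := by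
    refine natDegree_comp_le.trans ?_
    have : (C a + C (b - a) * X : ℝ[X]).natDegree ≤ 1 := by compute_degree
    nlinarith
  have key := h P hP F (by
      rw [hPe]; simpa [hpa] using hf a ⟨le_rfl, hab.le⟩) (by
    intro i hi
    -- Chosen so that `q'` is the `i`-th monomial in the coordinate rescaled to `[0, 1]`; its degree
    -- `i + 1` is admissible because `i < k`.
    let q : ℝ[X] := C ((i + 1 : ℝ)⁻¹ * (b - a)) * (C ((b - a)⁻¹) * (X - C a)) ^ (i + 1)
    have hq : q.natDegree ≤ k := by
      refine le_trans (b := i + 1) ?_ hi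
      have : (C ((b - a)⁻¹) * (X - C a) : ℝ[X]).natDegree ≤ 1 := by compute_degree
      refine (natDegree_C_mul_le _ _).trans (natDegree_pow_le.trans ?_)
      nlinarith
    have hq' : ∀ y, q.derivative.eval y = ((y - a) / (b - a)) ^ i := by
      intro y
      have : (i : ℝ) + 1 ≠ 0 := by positivity
      simp [q, derivative_pow]
      field_simp
    have h1 := hpf q hq
    simp_rw [hq'] at h1
    have h2 : ∫ x in (0 : ℝ)..1, P.eval x * x ^ i
        = (b - a)⁻¹ * ∫ y in a..b, p.eval y * ((y - a) / (b - a)) ^ i := by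
      have := intervalIntegral.integral_comp_add_mul (a := 0) (b := 1)
        (fun y => p.eval y * ((y - a) / (b - a)) ^ i) hba.ne' a
      simp only [mul_zero, add_zero, mul_one, add_sub_cancel, smul_eq_mul] at this
      rw [← this]
      refine intervalIntegral.integral_congr fun x _ => ?_
      simp only [hPe, add_sub_cancel_left]
      rw [mul_div_cancel_left₀ _ hba.ne']
    rw [h2, h1, abs_mul, abs_of_pos (inv_pos.2 hba), inv_mul_le_iff₀ hba, ← Real.norm_eq_abs,
      mul_comm]
    refine (intervalIntegral.norm_integral_le_of_norm_le_const (C := F) fun y hy => ?_).trans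
      (by rw [abs_of_pos hba])
    rw [uIoc_of_le hab.le] at hy
    rw [norm_mul, norm_pow, Real.norm_eq_abs, Real.norm_eq_abs]
    have h3 : |(y - a) / (b - a)| ^ i ≤ 1 := by
      refine pow_le_one₀ (abs_nonneg _) ?_
      rw [abs_of_nonneg (div_nonneg (by linarith [hy.1]) hba.le), div_le_one hba]
      linarith [hy.2]
    exact (mul_le_mul (hf y ⟨hy.1.le, hy.2⟩) h3 (by positivity)
      ((abs_nonneg _).trans (hf y ⟨hy.1.le, hy.2⟩))).trans (mul_one F).le)
    ((y - a) / (b - a)) ⟨div_nonneg (by linarith [hy.1]) hba.le, by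
      rw [div_le_one hba]; linarith [hy.2]⟩
  rwa [hPe, mul_div_cancel₀ _ hba.ne', add_sub_cancel] at key

theorem exists_antiderivative (p : ℝ[X]) (n : ℕ) (hp : p.degree < n) :
    ∃ q : ℝ[X], q.derivative = p ∧ q.degree < (n + 1 : ℕ) := by
  refine ⟨∑ i ∈ Finset.range n, C (p.coeff i / (i + 1)) * X ^ (i + 1), ?_, ?_⟩
  · rw [derivative_sum]
    have hsum : p = ∑ i ∈ Finset.range n, C (p.coeff i) * X ^ i := by
      ext m
      simp only [finsetSum_coeff, coeff_C_mul_X_pow, Finset.sum_ite_eq, Finset.mem_range]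
      split_ifs with hm
      · rfl
      · exact coeff_eq_zero_of_degree_lt (hp.trans_le (by exact_mod_cast not_lt.1 hm))
    conv_rhs => rw [hsum]
    refine Finset.sum_congr rfl fun i _ => ?_
    rw [derivative_C_mul_X_pow]
    have : (i : ℝ) + 1 ≠ 0 := by positivity
    congr 2
    push_cast
    field_simp
  · rw [← mem_degreeLT]
    refine Submodule.sum_mem _ fun i hi => mem_degreeLT.2 ((degree_C_mul_X_pow_le _ _).trans_lt ?_)
    have := Finset.mem_range.1 hi
    exact_mod_cast (by omega : i + 1 < n + 1)

/-! ### Local polynomial approximation of smooth functions of `(y, s)` -/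

theorem exists_hasDerivWithinAt_fst {yL yR T : ℝ} (hI : yL < yR) (hT : 0 < T) {f : ℝ → ℝ → ℝ}
    (hf : ContDiffOn ℝ ((⊤ : ℕ∞) : WithTop ℕ∞) (Function.uncurry f) (Icc yL yR ×ˢ Icc 0 T)) :
    ∃ f' : ℝ → ℝ → ℝ,
      ContDiffOn ℝ ((⊤ : ℕ∞) : WithTop ℕ∞) (Function.uncurry f') (Icc yL yR ×ˢ Icc 0 T) ∧
      ∀ y ∈ Icc yL yR, ∀ s ∈ Icc 0 T,
        HasDerivWithinAt (fun z => f z s) (f' y s) (Icc yL yR) y := by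
  have hU : UniqueDiffOn ℝ (Icc yL yR ×ˢ Icc 0 T) :=
    (uniqueDiffOn_Icc hI).prod (uniqueDiffOn_Icc hT)
  refine ⟨fun y s => fderivWithin ℝ (Function.uncurry f) (Icc yL yR ×ˢ Icc 0 T) (y, s) (1, 0),
    ?_, ?_⟩
  · exact (hf.fderivWithin hU (by simp)).clm_apply contDiffOn_const
  · intro y hy s hs
    have h1 := ((hf.differentiableOn (by simp)) (y, s) (mk_mem_prod hy hs)).hasFDerivWithinAt
    have h2 : HasDerivWithinAt (fun z : ℝ => (z, s)) ((1 : ℝ), (0 : ℝ)) (Icc yL yR) y :=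
      (hasDerivWithinAt_id y _).prodMk (hasDerivWithinAt_const y _ s)
    exact h1.comp_hasDerivWithinAt y h2 fun z hz => mk_mem_prod hz hs

theorem exists_bound_of_smooth {yL yR T : ℝ} {f : ℝ → ℝ → ℝ}
    (hf : ContDiffOn ℝ ((⊤ : ℕ∞) : WithTop ℕ∞) (Function.uncurry f) (Icc yL yR ×ˢ Icc 0 T)) :
    ∃ K : ℝ, 0 < K ∧ ∀ y ∈ Icc yL yR, ∀ s ∈ Icc 0 T, |f y s| ≤ K := by
  obtain ⟨K, hK⟩ := (isCompact_Icc.prod isCompact_Icc).exists_bound_of_continuousOn hf.continuousOn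
  exact ⟨max K 1, by positivity, fun y hy s hs =>
    (hK (y, s) (mk_mem_prod hy hs)).trans (le_max_left _ _)⟩

/-- Induction replaces Taylor's formula: integrate an approximation of `∂_y f`, match the value at
`a`, and gain a factor `b - a` from the mean value inequality. Bounding the degree strictly by `n`
lets the induction start at `n = 0` with the zero polynomial. Compactness in `s` makes the constant
uniform in time. -/
theorem exists_approx_degree_lt {yL yR T : ℝ} (hI : yL < yR) (hT : 0 < T) (n : ℕ) :
    ∀ f : ℝ → ℝ → ℝ,
      ContDiffOn ℝ ((⊤ : ℕ∞) : WithTop ℕ∞) (Function.uncurry f) (Icc yL yR ×ˢ Icc 0 T) →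
      ∃ K : ℝ, 0 < K ∧ ∀ s ∈ Icc 0 T, ∀ a b : ℝ, a < b → Icc a b ⊆ Icc yL yR →
        ∃ p : ℝ[X], p.degree < n ∧ ∀ y ∈ Icc a b, |f y s - p.eval y| ≤ K * (b - a) ^ n := by
  induction n with
  | zero =>
    intro f hf
    obtain ⟨K, hK, h⟩ := exists_bound_of_smooth hf
    exact ⟨K, hK, fun s hs a b _ hsub => ⟨0, by simp, fun y hy => by
      simpa using h y (hsub hy) s hs⟩⟩
  | succ n ih =>
    intro f hf
    obtain ⟨f', hf', hd⟩ := exists_hasDerivWithinAt_fst hI hT hf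
    obtain ⟨K, hK, h⟩ := ih f' hf'
    refine ⟨K, hK, fun s hs a b hab hsub => ?_⟩
    obtain ⟨p, hp, hpa⟩ := h s hs a b hab hsub
    obtain ⟨q, hq, hqd⟩ := exists_antiderivative p n hp
    refine ⟨q + C (f a s - q.eval a), ?_, fun y hy => ?_⟩
    · rw [← mem_degreeLT] at hqd ⊢
      refine Submodule.add_mem _ hqd (mem_degreeLT.2 (degree_C_le.trans_lt ?_))
      exact_mod_cast n.succ_pos
    · have hder : ∀ x ∈ Icc a b, HasDerivWithinAt (fun z => f z s - q.eval z)
          (f' x s - p.eval x) (Icc a b) x := fun x hx =>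
        ((hd x (hsub hx) s hs).mono hsub).sub (hq ▸ (q.hasDerivAt x).hasDerivWithinAt)
      have := (convex_Icc a b).norm_image_sub_le_of_norm_hasDerivWithin_le hder
        (fun x hx => hpa x hx) ⟨le_rfl, hab.le⟩ hy
      rw [Real.norm_eq_abs, Real.norm_eq_abs] at this
      have h1 : f y s - (q + C (f a s - q.eval a)).eval y
          = f y s - q.eval y - (f a s - q.eval a) := by simp; ring
      rw [h1]
      refine this.trans ?_
      rw [pow_succ, ← mul_assoc, abs_of_nonneg (by linarith [hy.1])]
      have := hy.2
      have : 0 < b - a := by linarith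
      gcongr

/-! ### Time-dependent polynomials -/

/-- Interpolation at `0, …, k` reduces regularity of `(y, s) ↦ (p s).eval y` to that of finitely
many functions of `s`, although the scheme only provides differentiability for each fixed `y`. -/
theorem exists_lagrange (k : ℕ) : ∃ L : ℕ → ℝ[X], (∀ i, (L i).natDegree ≤ k) ∧
    ∀ p : ℝ[X], p.natDegree ≤ k → ∀ y : ℝ,
      p.eval y = ∑ i ∈ Finset.range (k + 1), p.eval (i : ℝ) * (L i).eval y := by
  have hinj : Set.InjOn (fun i : ℕ => (i : ℝ)) (Finset.range (k + 1)) :=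
    Nat.cast_injective.injOn
  refine ⟨fun i => if i ∈ Finset.range (k + 1) then
    Lagrange.basis (Finset.range (k + 1)) (fun i : ℕ => (i : ℝ)) i else 0, fun i => ?_,
    fun p hp y => ?_⟩
  · dsimp only
    split_ifs with hi
    · rw [Lagrange.natDegree_basis hinj hi]
      simp
    · simp
  · have h := Lagrange.eq_interpolate (f := p) hinj (by
      rw [Finset.card_range]
      exact (natDegree_le_iff_degree_le.1 hp).trans_lt (by exact_mod_cast k.lt_succ_self))
    conv_lhs => rw [h, Lagrange.interpolate_apply, eval_finsetSum]
    refine Finset.sum_congr rfl fun i hi => ?_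
    simp only [if_pos hi, eval_mul, eval_C]

section TimeDependent

variable {k : ℕ} {T : ℝ} {p : ℝ → ℝ[X]}

theorem exists_derivative_polynomial (hp : ∀ s ∈ Icc 0 T, (p s).natDegree ≤ k)
    (hd : ∀ y, DifferentiableOn ℝ (fun s => (p s).eval y) (Icc 0 T)) {s : ℝ} (hs : s ∈ Icc 0 T) :
    ∃ D : ℝ[X], D.natDegree ≤ k ∧
      ∀ y, HasDerivWithinAt (fun τ => (p τ).eval y) (D.eval y) (Icc 0 T) s := by
  obtain ⟨L, hL, h⟩ := exists_lagrange k
  refine ⟨∑ i ∈ Finset.range (k + 1),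
    C (derivWithin (fun τ => (p τ).eval (i : ℝ)) (Icc 0 T) s) * L i, ?_, fun y => ?_⟩
  · exact natDegree_sum_le_of_forall_le _ _ fun i _ => (natDegree_C_mul_le _ _).trans (hL i)
  · have h1 : HasDerivWithinAt
        (fun τ => ∑ i ∈ Finset.range (k + 1), (p τ).eval (i : ℝ) * (L i).eval y)
        (∑ i ∈ Finset.range (k + 1),
          derivWithin (fun τ => (p τ).eval (i : ℝ)) (Icc 0 T) s * (L i).eval y) (Icc 0 T) s :=
      HasDerivWithinAt.fun_sum fun i _ => ((hd i s hs).hasDerivWithinAt).mul_const _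
    rw [eval_finsetSum]
    simp_rw [eval_mul, eval_C]
    exact h1.congr (fun τ hτ => h _ (hp τ hτ) y) (h _ (hp s hs) y)

theorem continuousOn_uncurry_eval (hp : ∀ s ∈ Icc 0 T, (p s).natDegree ≤ k)
    (hd : ∀ y, DifferentiableOn ℝ (fun s => (p s).eval y) (Icc 0 T)) (A : Set ℝ) :
    ContinuousOn (Function.uncurry fun y s => (p s).eval y) (A ×ˢ Icc 0 T) := by
  obtain ⟨L, -, h⟩ := exists_lagrange k
  have h1 : ContinuousOn (fun z : ℝ × ℝ =>
      ∑ i ∈ Finset.range (k + 1), (p z.2).eval (i : ℝ) * (L i).eval z.1) (A ×ˢ Icc 0 T) := by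
    refine continuousOn_finsetSum _ fun i _ => ContinuousOn.mul ?_ ?_
    · exact (hd i).continuousOn.comp continuousOn_snd fun z hz => hz.2
    · exact ((L i).continuous.comp continuous_fst).continuousOn
  exact h1.congr fun z hz => h _ (hp z.2 hz.2) z.1

/-- Differentiability at `s` bounds increments from `s`, uniformly in `y` since only `k + 1` nodal
values are involved. It stands in for a bound on the time derivative near `s`, which is not
available. -/
theorem eventually_lipschitz_eval (hp : ∀ s ∈ Icc 0 T, (p s).natDegree ≤ k)
    (hd : ∀ y, DifferentiableOn ℝ (fun s => (p s).eval y) (Icc 0 T)) {s : ℝ} (hs : s ∈ Ioo 0 T)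
    (a b : ℝ) :
    ∃ B : ℝ, ∀ᶠ τ in nhds s, ∀ y ∈ Icc a b, |(p τ).eval y - (p s).eval y| ≤ B * |τ - s| := by
  obtain ⟨L, -, h⟩ := exists_lagrange k
  have hnhds : Icc 0 T ∈ nhds s := Icc_mem_nhds hs.1 hs.2
  have h1 : ∀ i : ℕ, ∃ c, ∀ᶠ τ in nhds s, ‖(p τ).eval (i : ℝ) - (p s).eval (i : ℝ)‖
      ≤ c * ‖τ - s‖ := fun i =>
    (((hd i s (Ioo_subset_Icc_self hs)).differentiableAt hnhds).hasDerivAt.isBigO_sub).bound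
  choose c hc using h1
  have h2 : ∀ i : ℕ, ∃ m, ∀ y ∈ Icc a b, ‖(L i).eval y‖ ≤ m := fun i =>
    isCompact_Icc.exists_bound_of_continuousOn (L i).continuous.continuousOn
  choose m hm using h2
  refine ⟨∑ i ∈ Finset.range (k + 1), c i * m i, ?_⟩
  have h3 : ∀ᶠ τ in nhds s, ∀ i ∈ Finset.range (k + 1),
      ‖(p τ).eval (i : ℝ) - (p s).eval (i : ℝ)‖ ≤ c i * ‖τ - s‖ :=
    (Filter.eventually_all_finset _).2 fun i _ => hc i
  filter_upwards [h3, hnhds] with τ hτ hτT y hy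
  rw [h _ (hp τ hτT) y, h _ (hp s (Ioo_subset_Icc_self hs)) y, ← Finset.sum_sub_distrib,
    Finset.sum_mul]
  refine (Finset.abs_sum_le_sum_abs _ _).trans (Finset.sum_le_sum fun i hi => ?_)
  rw [← sub_mul, abs_mul, mul_right_comm]
  exact mul_le_mul (hτ i hi) (hm i y hy) (abs_nonneg _) ((norm_nonneg _).trans (hτ i hi))

end TimeDependent

theorem continuousOn_parametric_integral {a b T : ℝ} (hab : a ≤ b) (hT : 0 ≤ T)
    {g : ℝ → ℝ → ℝ} (hg : ContinuousOn (Function.uncurry g) (Icc a b ×ˢ Icc 0 T)) :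
    ContinuousOn (fun s => ∫ y in a..b, g y s) (Icc 0 T) := by
  -- Composing with the projections onto the two intervals extends `g` continuously to the whole
  -- plane without changing it on the rectangle.
  have h1 : Continuous (Function.uncurry
      fun (s y : ℝ) => g (projIcc a b hab y) (projIcc 0 T hT s)) := by
    refine hg.comp_continuous (f := fun z : ℝ × ℝ =>
      (((projIcc a b hab z.2 : ℝ)), ((projIcc 0 T hT z.1 : ℝ)))) ?_
      fun z => mk_mem_prod (projIcc a b hab z.2).2 (projIcc 0 T hT z.1).2
    fun_prop
  refine (intervalIntegral.continuous_parametric_intervalIntegral_of_continuous'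
    (μ := MeasureTheory.volume) h1 a b).continuousOn.congr fun s hs => ?_
  refine intervalIntegral.integral_congr fun y hy => ?_
  rw [uIcc_of_le hab] at hy
  simp only [projIcc_of_mem hab hy, projIcc_of_mem hT hs]

/-- Differentiation in time of the squared `L²` distance on a cell between a smooth function and a
polynomial of bounded degree. -/
theorem hasDerivAt_integral_sq {a b T : ℝ} (hab : a ≤ b) {f f' : ℝ → ℝ → ℝ}
    (hf : ContinuousOn (Function.uncurry f) (Icc a b ×ˢ Icc 0 T))
    (hf' : ContinuousOn (Function.uncurry f') (Icc a b ×ˢ Icc 0 T))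
    (hff' : ∀ y ∈ Icc a b, ∀ s ∈ Icc 0 T, HasDerivWithinAt (f y) (f' y s) (Icc 0 T) s)
    {k : ℕ} {p : ℝ → ℝ[X]} (hp : ∀ s ∈ Icc 0 T, (p s).natDegree ≤ k)
    (hd : ∀ y, DifferentiableOn ℝ (fun s => (p s).eval y) (Icc 0 T)) {s : ℝ} (hs : s ∈ Ioo 0 T)
    {D : ℝ[X]} (hD : ∀ y, HasDerivWithinAt (fun τ => (p τ).eval y) (D.eval y) (Icc 0 T) s) :
    HasDerivAt (fun τ => ∫ y in a..b, (f y τ - (p τ).eval y) ^ 2)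
      (∫ y in a..b, 2 * (f y s - (p s).eval y) * (f' y s - D.eval y)) s := by
  have hsI : s ∈ Icc 0 T := Ioo_subset_Icc_self hs
  have hnhds : Icc 0 T ∈ nhds s := Icc_mem_nhds hs.1 hs.2
  have hpc := continuousOn_uncurry_eval hp hd (Icc a b)
  have hec : ContinuousOn (Function.uncurry fun y τ => f y τ - (p τ).eval y)
      (Icc a b ×ˢ Icc 0 T) := hf.sub hpc
  obtain ⟨A, hA⟩ := (isCompact_Icc.prod isCompact_Icc).exists_bound_of_continuousOn hec
  obtain ⟨B', hB'⟩ := (isCompact_Icc.prod isCompact_Icc).exists_bound_of_continuousOn hf'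
  obtain ⟨B, hB⟩ := eventually_lipschitz_eval hp hd hs a b
  have hslice : ∀ {g : ℝ → ℝ → ℝ}, ContinuousOn (Function.uncurry g) (Icc a b ×ˢ Icc 0 T) →
      ∀ τ ∈ Icc 0 T, ContinuousOn (fun y => g y τ) (Icc a b) := fun hg τ hτ =>
    hg.comp (f := fun y : ℝ => (y, τ)) (by fun_prop) fun y hy => mk_mem_prod hy hτ
  have hmeas : ∀ {g : ℝ → ℝ}, ContinuousOn g (Icc a b) →
      MeasureTheory.IntegrableOn g (Ioc a b) := fun hg =>
    (hg.integrableOn_Icc).mono_set Ioc_subset_Icc_self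
  have hF' : ContinuousOn (fun y => 2 * (f y s - (p s).eval y) * (f' y s - D.eval y)) (Icc a b) :=
    (continuousOn_const.mul (hslice hec s hsI)).mul
      ((hslice hf' s hsI).sub D.continuous.continuousOn)
  obtain ⟨S, hS, hBS⟩ := Filter.eventually_iff_exists_mem.1 (hB.and hnhds)
  have hder : ∀ y ∈ Icc a b, HasDerivAt (fun τ => (f y τ - (p τ).eval y) ^ 2)
      (2 * (f y s - (p s).eval y) * (f' y s - D.eval y)) s := by
    intro y hy
    have := (((hff' y hy s hsI).sub (hD y)).hasDerivAt hnhds).pow 2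
    simp only [Nat.cast_ofNat, Nat.add_one_sub_one, pow_one] at this
    exact this
  -- This form of differentiation under the integral needs a Lipschitz bound only between `τ` and
  -- the base point `s`. The constant comes from factoring the difference of squares: the sum is at
  -- most `2 A`, the difference at most `(B' + B) |τ - s|`.
  have key := hasFDerivAt_integral_of_dominated_loc_of_lip' (𝕜 := ℝ)
    (μ := MeasureTheory.volume.restrict (Ioc a b))
    (F := fun τ y => (f y τ - (p τ).eval y) ^ 2) (x₀ := s) (s := S)
    (bound := fun _ => 2 * A * (B' + B))
    (F' := fun y => (1 : ℝ →L[ℝ] ℝ).smulRight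
      (2 * (f y s - (p s).eval y) * (f' y s - D.eval y))) hS
    (fun τ hτ => (hmeas ((hslice hec τ (hBS τ hτ).2).pow 2)).aestronglyMeasurable)
    (hmeas ((hslice hec s hsI).pow 2))
    (by
      have h1 := (hmeas hF').aestronglyMeasurable
      exact (ContinuousLinearMap.smulRightL ℝ ℝ ℝ 1).continuous.comp_aestronglyMeasurable h1)
    (by
      refine (MeasureTheory.ae_restrict_iff' measurableSet_Ioc).2 (Filter.Eventually.of_forall
        fun y hy τ hτ => ?_)
      replace hy := Ioc_subset_Icc_self hy
      obtain ⟨hτB, hτT⟩ := hBS τ hτ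
      have h1 := hA (y, τ) (mk_mem_prod hy hτT)
      have h2 := hA (y, s) (mk_mem_prod hy hsI)
      have h3 := hτB y hy
      have h4 := (convex_Icc 0 T).norm_image_sub_le_of_norm_hasDerivWithin_le (hff' y hy)
        (fun σ hσ => hB' (y, σ) (mk_mem_prod hy hσ)) hsI hτT
      simp only [Function.uncurry_apply_pair, Real.norm_eq_abs] at h1 h2 h4 ⊢
      have h5 : (f y τ - (p τ).eval y) ^ 2 - (f y s - (p s).eval y) ^ 2
          = ((f y τ - (p τ).eval y) + (f y s - (p s).eval y))
            * ((f y τ - f y s) - ((p τ).eval y - (p s).eval y)) := by ring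
      rw [h5, abs_mul, mul_assoc]
      refine mul_le_mul ((abs_add_le _ _).trans (by linarith)) ((abs_sub _ _).trans ?_)
        (abs_nonneg _) (by linarith [abs_nonneg (f y τ - (p τ).eval y)])
      linarith)
    (MeasureTheory.integrable_const _)
    (by
      refine (MeasureTheory.ae_restrict_iff' measurableSet_Ioc).2 (Filter.Eventually.of_forall
        fun y hy => ?_)
      exact (hder y (Ioc_subset_Icc_self hy)).hasFDerivAt)
  have h2 := key.2.hasDerivAt
  rw [ContinuousLinearMap.integral_apply key.1] at h2
  simpa [intervalIntegral.integral_of_le hab] using h2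

/-! ### Meshes -/

namespace Mesh

variable {yL yR : ℝ} (M : Mesh yL yR)

theorem left_lt_right (j : Fin M.N) : M.left j < M.right j :=
  M.strictMono_node Fin.castSucc_lt_succ

theorem node_mem (j : Fin (M.N + 1)) : M.node j ∈ Icc yL yR := by
  constructor
  · exact M.node_zero.symm.trans_le (M.strictMono_node.monotone (Fin.zero_le j))
  · exact (M.strictMono_node.monotone (Fin.le_last j)).trans_eq M.node_last

theorem cell_subset (j : Fin M.N) : Icc (M.left j) (M.right j) ⊆ Icc yL yR :=
  Icc_subset_Icc (M.node_mem _).1 (M.node_mem _).2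

theorem right_sub_left_le_size (j : Fin M.N) : M.right j - M.left j ≤ M.size :=
  le_ciSup (f := fun j => M.right j - M.left j) (Set.finite_range _).bddAbove j

theorem size_pos : 0 < M.size :=
  (sub_pos.2 (M.left_lt_right ⟨0, M.N_pos⟩)).trans_le (M.right_sub_left_le_size _)

theorem size_le : M.size ≤ yR - yL := by
  have : Nonempty (Fin M.N) := ⟨⟨0, M.N_pos⟩⟩
  refine ciSup_le fun j => ?_
  have h1 : yL ≤ M.left j := (M.node_mem _).1
  have h2 : M.right j ≤ yR := (M.node_mem _).2
  linarith

/-- The nodes indexed by `ℕ`. -/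
def natNode (i : ℕ) : ℝ := M.node (Fin.ofNat (M.N + 1) i)

theorem natNode_castSucc (j : Fin M.N) : M.natNode j = M.left j := by
  unfold natNode left
  congr 1
  ext
  simp [Fin.ofNat, Nat.mod_eq_of_lt (show (j : ℕ) < M.N + 1 by omega)]

theorem natNode_succ (j : Fin M.N) : M.natNode (j + 1) = M.right j := by
  unfold natNode right
  congr 1
  ext
  simp [Fin.ofNat, Nat.mod_eq_of_lt (show (j : ℕ) + 1 < M.N + 1 by omega)]

theorem natNode_zero : M.natNode 0 = yL := M.node_zero

theorem natNode_N : M.natNode M.N = yR := by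
  refine Eq.trans ?_ M.node_last
  unfold natNode
  congr 1
  ext
  simp [Fin.ofNat]

variable {M}

theorem intervalIntegrable_of_cells {g : ℝ → ℝ}
    (hg : ∀ j, IntervalIntegrable g MeasureTheory.volume (M.left j) (M.right j)) :
    IntervalIntegrable g MeasureTheory.volume yL yR := by
  have := IntervalIntegrable.trans_iterate (f := g) (μ := MeasureTheory.volume) (a := M.natNode)
    (n := M.N) (fun i hi => by
      have := hg ⟨i, hi⟩
      rwa [← natNode_castSucc, ← natNode_succ] at this)
  rwa [natNode_zero, natNode_N] at this

theorem integral_eq_sum_cells {g : ℝ → ℝ}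
    (hg : ∀ j, IntervalIntegrable g MeasureTheory.volume (M.left j) (M.right j)) :
    ∫ y in yL..yR, g y = ∑ j, ∫ y in M.left j..M.right j, g y := by
  have := intervalIntegral.sum_integral_adjacent_intervals (f := g) (μ := MeasureTheory.volume)
    (a := M.natNode) (n := M.N) (fun i hi => by
      have := hg ⟨i, hi⟩
      rwa [← natNode_castSucc, ← natNode_succ] at this)
  rw [natNode_zero, natNode_N, Finset.sum_range] at this
  rw [← this]
  simp_rw [natNode_castSucc, natNode_succ]

theorem sum_lengths : ∑ j, (M.right j - M.left j) = yR - yL := by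
  have := integral_eq_sum_cells (M := M) (g := fun _ => 1) fun j => intervalIntegrable_const
  simpa using this.symm

theorem toFun_eq (v : M.Broken) (j : Fin M.N) {y : ℝ} (hy : y ∈ Ico (M.left j) (M.right j)) :
    v.toFun y = (v j).eval y := by
  unfold Broken.toFun
  rw [Finset.sum_eq_single j, indicator_of_mem hy]
  · intro i _ hij
    refine indicator_of_notMem (fun hi => ?_) _
    rcases lt_or_gt_of_ne hij with h | h
    · have : M.right i ≤ M.left j := M.strictMono_node.monotone (Fin.succ_le_castSucc_iff.2 h)
      linarith [hi.2, hy.1]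
    · have : M.right j ≤ M.left i := M.strictMono_node.monotone (Fin.succ_le_castSucc_iff.2 h)
      linarith [hi.1, hy.2]
  · simp

/-- Only the open cell is used: at its right end `toFun` takes the value from the next cell, or `0`
at `yR`. -/
theorem eqOn_toFun (v : M.Broken) (j : Fin M.N) (G : ℝ → ℝ → ℝ) :
    EqOn (fun y => G y (v.toFun y)) (fun y => G y ((v j).eval y))
      (uIoo (M.left j) (M.right j)) := by
  intro y hy
  rw [uIoo_of_le (M.left_lt_right j).le] at hy
  simp only [toFun_eq v j ⟨hy.1.le, hy.2⟩]

theorem intervalIntegrable_toFun (v : M.Broken) (j : Fin M.N) (G : ℝ → ℝ → ℝ)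
    (hG : ContinuousOn (fun y => G y ((v j).eval y)) (Icc (M.left j) (M.right j))) :
    IntervalIntegrable (fun y => G y (v.toFun y)) MeasureTheory.volume (M.left j) (M.right j) :=
  (intervalIntegrable_congr_uIoo (eqOn_toFun v j G)).2
    (hG.intervalIntegrable_of_Icc (M.left_lt_right j).le)

theorem integral_toFun_cell (v : M.Broken) (j : Fin M.N) (G : ℝ → ℝ → ℝ) :
    ∫ y in M.left j..M.right j, G y (v.toFun y) = ∫ y in M.left j..M.right j, G y ((v j).eval y) :=
  intervalIntegral.integral_congr_uIoo (eqOn_toFun v j G)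

theorem l2norm_sub_toFun_sq {f : ℝ → ℝ} (hf : ContinuousOn f (Icc yL yR)) (v : M.Broken) :
    l2norm yL yR (fun y => f y - v.toFun y) ^ 2
      = ∑ j, ∫ y in M.left j..M.right j, (f y - (v j).eval y) ^ 2 := by
  have h0 : yL ≤ yR := (M.node_mem 0).1.trans (M.node_mem 0).2
  unfold l2norm
  rw [Real.sq_sqrt (intervalIntegral.integral_nonneg h0 fun y _ => sq_nonneg _),
    integral_eq_sum_cells (M := M) (fun j => intervalIntegrable_toFun v j
      (fun y z => (f y - z) ^ 2)
      (((hf.mono (M.cell_subset j)).sub (v j).continuous.continuousOn).pow 2))]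
  exact Finset.sum_congr rfl fun j _ => integral_toFun_cell v j fun y z => (f y - z) ^ 2

end Mesh

theorem l2norm_nonneg (a b : ℝ) (f : ℝ → ℝ) : 0 ≤ l2norm a b f := Real.sqrt_nonneg _

/-- Cauchy–Schwarz against the constant `1`, read off from the nonnegative variance of `|g|`. -/
theorem sq_integral_abs_le {a b : ℝ} (hab : a < b) {g : ℝ → ℝ}
    (hg : IntervalIntegrable (fun y => |g y|) MeasureTheory.volume a b)
    (hg2 : IntervalIntegrable (fun y => g y ^ 2) MeasureTheory.volume a b) :
    (∫ y in a..b, |g y|) ^ 2 ≤ (b - a) * ∫ y in a..b, g y ^ 2 := by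
  have hba : 0 < b - a := sub_pos.2 hab
  set A := ∫ y in a..b, |g y|
  have h1 : ∫ y in a..b, (|g y| - A / (b - a)) ^ 2
      = (∫ y in a..b, g y ^ 2) - 2 * (A / (b - a)) * A + (A / (b - a)) ^ 2 * (b - a) := by
    have : ∀ y, (|g y| - A / (b - a)) ^ 2
        = g y ^ 2 - 2 * (A / (b - a)) * |g y| + (A / (b - a)) ^ 2 := fun y => by
      rw [sub_sq, sq_abs]; ring
    simp_rw [this]
    rw [intervalIntegral.integral_add (hg2.sub (hg.const_mul _)) intervalIntegrable_const,
      intervalIntegral.integral_sub hg2 (hg.const_mul _), intervalIntegral.integral_const_mul,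
      intervalIntegral.integral_const, smul_eq_mul]
    ring
  have h2 : 0 ≤ ∫ y in a..b, (|g y| - A / (b - a)) ^ 2 :=
    intervalIntegral.integral_nonneg hab.le fun y _ => sq_nonneg _
  rw [h1] at h2
  have h3 : (∫ y in a..b, g y ^ 2) - 2 * (A / (b - a)) * A + (A / (b - a)) ^ 2 * (b - a)
      = (∫ y in a..b, g y ^ 2) - A ^ 2 / (b - a) := by
    field_simp
    ring
  rw [h3, sub_nonneg, div_le_iff₀ hba] at h2
  linarith

/-! ### The error of `u_h` -/

section FluxError

variable {yL yR : ℝ} {M : Mesh yL yR} {k : ℕ} {f g : ℝ → ℝ} {v z : M.Broken} {γ : ℝ}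

theorem Mesh.fluxPlus_castSucc (v : M.Broken) (γ : ℝ) (j : Fin M.N) :
    Mesh.fluxPlus v γ j.castSucc = (v j).eval (M.left j) := by
  simp [Mesh.fluxPlus]

theorem Mesh.fluxPlus_last (v : M.Broken) (γ : ℝ) :
    Mesh.fluxPlus v γ (Fin.last M.N) = γ := by
  simp [Mesh.fluxPlus]

theorem integral_eq_sub_of_subset (hfg : ∀ y ∈ Icc yL yR, HasDerivWithinAt f (g y) (Icc yL yR) y)
    (hg : ContinuousOn g (Icc yL yR)) {a b : ℝ} (hab : a ≤ b) (hsub : Icc a b ⊆ Icc yL yR) :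
    ∫ y in a..b, g y = f b - f a := by
  refine intervalIntegral.integral_eq_sub_of_hasDerivAt_of_le hab
    (fun y hy => ((hfg y (hsub hy)).mono hsub).continuousWithinAt) (fun y hy => ?_)
    ((hg.mono hsub).intervalIntegrable_of_Icc hab)
  exact ((hfg y (hsub (Ioo_subset_Icc_self hy))).mono hsub).hasDerivAt (Icc_mem_nhds hy.1 hy.2)

theorem intervalIntegrable_abs_sub_toFun (hg : ContinuousOn g (Icc yL yR)) (z : M.Broken) :
    IntervalIntegrable (fun y => |g y - z.toFun y|) MeasureTheory.volume yL yR :=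
  Mesh.intervalIntegrable_of_cells fun j => Mesh.intervalIntegrable_toFun z j
    (fun y w => |g y - w|) ((hg.mono (M.cell_subset j)).sub (z j).continuous.continuousOn).abs

theorem intervalIntegrable_abs_sub_toFun_subset (hg : ContinuousOn g (Icc yL yR))
    (z : M.Broken) {a b : ℝ} (ha : a ∈ Icc yL yR) (hb : b ∈ Icc yL yR) :
    IntervalIntegrable (fun y => |g y - z.toFun y|) MeasureTheory.volume a b :=
  (intervalIntegrable_abs_sub_toFun hg z).mono_set (by
    rw [uIcc_of_le (ha.1.trans ha.2)]
    exact uIcc_subset_Icc ha hb)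

/-- A tail of a cell contributes at most the tail of the `L¹` norm. -/
theorem abs_integral_sub_le_of_cell (g : ℝ → ℝ) (z : M.Broken)
    (j : Fin M.N) {y : ℝ} (hy : y ∈ Icc (M.left j) (M.right j)) :
    |∫ t in y..M.right j, (g t - (z j).eval t)| ≤ ∫ t in y..M.right j, |g t - z.toFun t| := by
  refine (intervalIntegral.abs_integral_le_integral_abs hy.2).trans_eq ?_
  refine intervalIntegral.integral_congr_Ioo_of_le hy.2 fun t ht => ?_
  simp only [Mesh.toFun_eq z j ⟨hy.1.trans ht.1.le, ht.2⟩]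

theorem flux_jump (heq : ∀ ψ ∈ M.dgSpace k, ∀ j,
      (∫ y in M.left j..M.right j, (z j).eval y * (ψ j).eval y)
        = Mesh.fluxPlus v γ j.succ * (ψ j).eval (M.right j)
          - Mesh.fluxPlus v γ j.castSucc * (ψ j).eval (M.left j)
          - ∫ y in M.left j..M.right j, (v j).eval y * (ψ j).derivative.eval y) (j : Fin M.N) :
    ∫ y in M.left j..M.right j, (z j).eval y
      = Mesh.fluxPlus v γ j.succ - Mesh.fluxPlus v γ j.castSucc := by
  have := heq (fun _ => 1) (fun _ => by simp) j
  simpa using this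

/-- The error vanishes at `yR`, where the flux is the exact datum; each step to the left adds the
integral of `g - z` over one cell. Hence the induction runs from the last node. -/
theorem abs_sub_flux_le (hfg : ∀ y ∈ Icc yL yR, HasDerivWithinAt f (g y) (Icc yL yR) y)
    (hg : ContinuousOn g (Icc yL yR)) (hγ : f yR = γ)
    (heq : ∀ ψ ∈ M.dgSpace k, ∀ j,
      (∫ y in M.left j..M.right j, (z j).eval y * (ψ j).eval y)
        = Mesh.fluxPlus v γ j.succ * (ψ j).eval (M.right j)
          - Mesh.fluxPlus v γ j.castSucc * (ψ j).eval (M.left j)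
          - ∫ y in M.left j..M.right j, (v j).eval y * (ψ j).derivative.eval y)
    (i : Fin (M.N + 1)) :
    |f (M.node i) - Mesh.fluxPlus v γ i| ≤ ∫ y in M.node i..yR, |g y - z.toFun y| := by
  induction i using Fin.reverseInduction with
  | last => simp [M.node_last, Mesh.fluxPlus_last, hγ]
  | cast j ih =>
    have hle := (M.left_lt_right j).le
    have hyR : yR ∈ Icc yL yR := ⟨(M.node_mem 0).1.trans (M.node_mem 0).2, le_rfl⟩
    have h1 := integral_eq_sub_of_subset hfg hg hle (M.cell_subset j)
    have h2 := flux_jump heq j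
    have h3 := abs_integral_sub_le_of_cell g z j (left_mem_Icc.2 hle)
    rw [intervalIntegral.integral_sub
      ((hg.mono (M.cell_subset j)).intervalIntegrable_of_Icc hle)
      ((z j).continuous.intervalIntegrable _ _), h1, h2] at h3
    have h4 := intervalIntegral.integral_add_adjacent_intervals
      (intervalIntegrable_abs_sub_toFun_subset hg z (M.node_mem j.castSucc) (M.node_mem j.succ))
      (intervalIntegrable_abs_sub_toFun_subset hg z (M.node_mem j.succ) hyR)
    rw [← h4]
    refine le_trans ?_ (add_le_add h3 ih)
    have h5 : f (M.node j.castSucc) - Mesh.fluxPlus v γ j.castSucc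
        = -(f (M.right j) - f (M.left j)
          - (Mesh.fluxPlus v γ j.succ - Mesh.fluxPlus v γ j.castSucc))
          + (f (M.node j.succ) - Mesh.fluxPlus v γ j.succ) := by
      simp only [Mesh.left, Mesh.right]
      ring
    rw [h5]
    refine (abs_add_le _ _).trans ?_
    rw [abs_neg]

/-- Pointwise error bound for the discrete antiderivative: on each cell it is the Gauss–Radau
projection of the exact antiderivative of the right-hand side. -/
theorem exists_antiderivative_error_bound (k : ℕ) : ∃ K : ℝ, 0 < K ∧
    ∀ {yL yR : ℝ} {M : Mesh yL yR} {f g : ℝ → ℝ} {v z : M.Broken} {γ : ℝ},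
    (∀ y ∈ Icc yL yR, HasDerivWithinAt f (g y) (Icc yL yR) y) →
    ContinuousOn g (Icc yL yR) → f yR = γ → v ∈ M.dgSpace k →
    (∀ ψ ∈ M.dgSpace k, ∀ j,
      (∫ y in M.left j..M.right j, (z j).eval y * (ψ j).eval y)
        = Mesh.fluxPlus v γ j.succ * (ψ j).eval (M.right j)
          - Mesh.fluxPlus v γ j.castSucc * (ψ j).eval (M.left j)
          - ∫ y in M.left j..M.right j, (v j).eval y * (ψ j).derivative.eval y) →
    ∀ (j : Fin M.N) (π : ℝ[X]) (κ : ℝ), π.natDegree ≤ k →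
    (∀ y ∈ Icc (M.left j) (M.right j), |f y - π.eval y| ≤ κ) →
    ∀ y ∈ Icc (M.left j) (M.right j),
      |f y - (v j).eval y| ≤ (1 + K) * κ + K * ∫ y in yL..yR, |g y - z.toFun y| := by
  obtain ⟨K, hK, hrad⟩ := exists_radau_bound k
  refine ⟨K, hK, ?_⟩
  intro yL yR M f g v z γ hfg hg hγ hv heq j π κ hπ hκ y hy
  set W := ∫ y in yL..yR, |g y - z.toFun y|
  have hlt := M.left_lt_right j
  have hyLR : yL ≤ yR := (M.node_mem 0).1.trans (M.node_mem 0).2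
  have hyR : yR ∈ Icc yL yR := ⟨hyLR, le_rfl⟩
  obtain ⟨Z, hZ, -⟩ := exists_antiderivative (z j) ((z j).natDegree + 1)
    (degree_le_natDegree.trans_lt (by exact_mod_cast Nat.lt_succ_self _))
  -- Normalised to equal the flux at the right end; the jump relation then forces it to agree with
  -- the trace of `v` at the left end.
  set U : ℝ[X] := Z + C (Mesh.fluxPlus v γ j.succ - Z.eval (M.right j)) with hU
  have hU' : U.derivative = z j := by simp [hU, hZ]
  have hUR : U.eval (M.right j) = Mesh.fluxPlus v γ j.succ := by simp [hU]
  have hUint : ∀ t, ∫ x in t..M.right j, (z j).eval x = U.eval (M.right j) - U.eval t := by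
    intro t
    rw [← hU']
    exact intervalIntegral.integral_eq_sub_of_hasDerivAt (fun x _ => U.hasDerivAt x)
      (U.derivative.continuous.intervalIntegrable _ _)
  have hUL : U.eval (M.left j) = (v j).eval (M.left j) := by
    have h1 := flux_jump heq j
    rw [hUint, hUR, Mesh.fluxPlus_castSucc] at h1
    linarith
  have hUf : ∀ t ∈ Icc (M.left j) (M.right j), |f t - U.eval t| ≤ W := by
    intro t ht
    have htI := M.cell_subset j ht
    have hsub : Icc t (M.right j) ⊆ Icc yL yR := Icc_subset_Icc htI.1 (M.node_mem _).2
    have h1 := integral_eq_sub_of_subset hfg hg ht.2 hsub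
    have h3 := abs_integral_sub_le_of_cell g z j ht
    rw [intervalIntegral.integral_sub ((hg.mono hsub).intervalIntegrable_of_Icc ht.2)
      ((z j).continuous.intervalIntegrable _ _), h1, hUint, hUR] at h3
    have h2 : |f (M.right j) - Mesh.fluxPlus v γ j.succ|
        ≤ ∫ y in M.right j..yR, |g y - z.toFun y| := abs_sub_flux_le hfg hg hγ heq j.succ
    have h4 := intervalIntegral.integral_add_adjacent_intervals
      (intervalIntegrable_abs_sub_toFun_subset hg z htI (M.node_mem j.succ))
      (intervalIntegrable_abs_sub_toFun_subset hg z (M.node_mem j.succ) hyR)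
    have h5 := intervalIntegral.integral_add_adjacent_intervals
      (intervalIntegrable_abs_sub_toFun_subset hg z ⟨le_rfl, hyLR⟩ htI)
      (intervalIntegrable_abs_sub_toFun_subset hg z htI hyR)
    have h6 : 0 ≤ ∫ y in yL..t, |g y - z.toFun y| :=
      intervalIntegral.integral_nonneg htI.1 fun _ _ => abs_nonneg _
    have h7 : f t - U.eval t = (f (M.right j) - Mesh.fluxPlus v γ j.succ)
        - (f (M.right j) - f t - (Mesh.fluxPlus v γ j.succ - U.eval t)) := by ring
    rw [h7]
    refine (abs_sub _ _).trans ?_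
    change _ + (∫ y in M.right j..yR, _) = _ at h4
    change (∫ y in t..M.right j, _) + _ = _ at h4
    linarith
  -- The projection reproduces polynomials of degree at most `k`, so `v - π` is the projection of `U
  -- - π`, which is bounded by `W + κ`. Equality of moments comes from integrating `∫ U q'` by parts
  -- and comparing with the scheme tested with `q`.
  have key := hrad (M.left j) (M.right j) hlt (v j - π)
    ((natDegree_sub_le _ _).trans (max_le (hv j) hπ)) (fun t => U.eval t - π.eval t) (W + κ)
    (fun t ht => by
      have h1 := hUf t ht
      have h2 := hκ t ht
      have h3 : U.eval t - π.eval t = -(f t - U.eval t) + (f t - π.eval t) := by ring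
      rw [h3]
      refine (abs_add_le _ _).trans ?_
      rw [abs_neg]
      linarith)
    (by simp [hUL])
    (fun q hq => by
      have h1 := heq (fun _ => q) (fun _ => hq) j
      have h2 := intervalIntegral.integral_mul_deriv_eq_deriv_mul (a := M.left j)
        (b := M.right j) (fun x _ => U.hasDerivAt x) (fun x _ => q.hasDerivAt x)
        (U.derivative.continuous.intervalIntegrable _ _)
        (q.derivative.continuous.intervalIntegrable _ _)
      rw [Mesh.fluxPlus_castSucc] at h1
      rw [hU', h1, hUR, hUL] at h2
      simp only [eval_sub, sub_mul]
      rw [intervalIntegral.integral_sub (Continuous.intervalIntegrable (by fun_prop) _ _)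
        (Continuous.intervalIntegrable (by fun_prop) _ _),
        intervalIntegral.integral_sub (Continuous.intervalIntegrable (by fun_prop) _ _)
        (Continuous.intervalIntegrable (by fun_prop) _ _), h2]
      ring)
    y hy
  have h2 := hκ y hy
  have h3 : f y - (v j).eval y = (f y - π.eval y) - (v j - π).eval y := by simp
  rw [h3]
  refine (abs_sub _ _).trans ?_
  nlinarith

end FluxError

/-! ### Algebra of the energy estimate -/

/-- Young's inequality for a residual `D + G`: testing with the error `w - q` is, up to a test
function in the discrete space, controlled by approximation errors. -/
theorem residual_mul_le (D G v w q p κ : ℝ) (hκ : |w - p| ≤ κ) :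
    -2 * (D + G) * (w - q) ≤ (D + G) * (2 * (q - p) + 2 * (D + v)) + (G - v) ^ 2 + κ ^ 2 := by
  have h1 : (w - p) ^ 2 ≤ κ ^ 2 := sq_le_sq' (neg_le_of_abs_le hκ) (le_of_abs_le hκ)
  -- The factor `D + v` in the test function replaces an `L²` projection: after moving everything to
  -- one side, what remains is `(D + G + (w - p))² + (D + v)²`, up to replacing `(w - p)²` by `κ²`.
  nlinarith [sq_nonneg (D + G + (w - p)), sq_nonneg (v + D)]

/-- The product is split so that `b - bh` meets `ah` and `a - ah` meets the exact `b`; thus no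
pointwise bound on `bh` is required. In the application `a` is `u` and `b` is `ρ` or `ω`. -/
theorem product_error_sq_le {a b ah bh v A B δ κ : ℝ} (ha : |b| ≤ A) (hah : |ah| ≤ B)
    (hδ : |a - ah| ≤ δ) (hκ : |a * b - v| ≤ κ) :
    (ah * bh - v) ^ 2 ≤ 3 * (B ^ 2 * (b - bh) ^ 2 + A ^ 2 * δ ^ 2 + κ ^ 2) := by
  have h1 : ah * bh - v = -(ah * (b - bh)) - (a - ah) * b + (a * b - v) := by ring
  have h2 : (ah * (b - bh)) ^ 2 ≤ B ^ 2 * (b - bh) ^ 2 := by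
    rw [mul_pow]
    exact mul_le_mul_of_nonneg_right (sq_le_sq' (neg_le_of_abs_le hah) (le_of_abs_le hah))
      (sq_nonneg _)
  have h3 : ((a - ah) * b) ^ 2 ≤ A ^ 2 * δ ^ 2 := by
    rw [mul_pow, mul_comm]
    exact mul_le_mul (sq_le_sq' (neg_le_of_abs_le ha) (le_of_abs_le ha))
      (sq_le_sq' (neg_le_of_abs_le hδ) (le_of_abs_le hδ)) (sq_nonneg _) (sq_nonneg _)
  have h4 : (a * b - v) ^ 2 ≤ κ ^ 2 := sq_le_sq' (neg_le_of_abs_le hκ) (le_of_abs_le hκ)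
  rw [h1]
  set x := ah * (b - bh)
  set y := (a - ah) * b
  set t := a * b - v
  nlinarith [sq_nonneg (x - y), sq_nonneg (x + t), sq_nonneg (y + t)]

theorem cross_term_le {x b e A δ : ℝ} (hx : |x| ≤ δ) (hb : |b| ≤ A) :
    2 * (x * (b * e)) ≤ δ ^ 2 + A ^ 2 * e ^ 2 := by
  have h1 : x ^ 2 ≤ δ ^ 2 := sq_le_sq' (neg_le_of_abs_le hx) (le_of_abs_le hx)
  have h2 : b ^ 2 ≤ A ^ 2 := sq_le_sq' (neg_le_of_abs_le hb) (le_of_abs_le hb)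
  nlinarith [sq_nonneg (x - b * e), mul_le_mul_of_nonneg_right h2 (sq_nonneg e)]

/-- The integrand of the time derivative of the error energy, up to residuals times discrete test
functions. -/
theorem energy_integrand_le {u ρ ω uh ρh ωh Dρ Dω v₁ v₂ π₁ π₂ A B δ κ : ℝ}
    (hρ : |ρ| ≤ A) (hω : |ω| ≤ A) (huh : |uh| ≤ B) (hδ : |u - uh| ≤ δ)
    (h₁ : |ρ - π₁| ≤ κ) (h₂ : |ω - π₂| ≤ κ) (h₃ : |u * ω - v₁| ≤ κ) (h₄ : |u * ρ - v₂| ≤ κ) :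
    2 * (ρ - ρh) * (-(u * ω) - Dρ) + 2 * (ω - ωh) * (ρ * u - Dω)
      ≤ (Dρ + uh * ωh) * (2 * (ρh - π₁) + 2 * (Dρ + v₁))
        + (Dω - ρh * uh) * (2 * (ωh - π₂) + 2 * (Dω - v₂))
        + (3 * B ^ 2 + 6 * A ^ 2 + 8) * ((ρ - ρh) ^ 2 + (ω - ωh) ^ 2 + (δ ^ 2 + κ ^ 2)) := by
  have r₁ := residual_mul_le Dρ (uh * ωh) v₁ ρ ρh π₁ κ h₁
  have r₂ := residual_mul_le Dω (-(uh * ρh)) (-v₂) ω ωh π₂ κ h₂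
  have p₁ := product_error_sq_le (bh := ωh) hω huh hδ h₃
  have p₂ := product_error_sq_le (bh := ρh) hρ huh hδ h₄
  have c₁ := cross_term_le (e := ω - ωh) hδ hρ
  have c₂ := cross_term_le (e := -(ρ - ρh)) hδ hω
  have e₁ := sq_nonneg (ρ - ρh)
  have e₂ := sq_nonneg (ω - ωh)
  have k₁ := sq_nonneg κ
  have k₂ := sq_nonneg δ
  have a₁ := mul_nonneg (sq_nonneg A) e₁
  have a₂ := mul_nonneg (sq_nonneg A) e₂
  have a₃ := mul_nonneg (sq_nonneg A) k₁
  have b₁ := mul_nonneg (sq_nonneg B) k₁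
  have b₂ := mul_nonneg (sq_nonneg B) k₂
  -- The products `uh * (ρ - ρh) * (ω - ωh)` from the two equations cancel here. The constant
  -- collects `3 B²` from the product errors, `6 A²` from their `δ` terms, and `2 (3 + 1) = 8`
  -- copies of `κ²`.
  linarith

/-! ### Gronwall's inequality -/

theorem gronwall_le {T c m : ℝ} (hc : 0 ≤ c) (hm : 0 ≤ m) {E E' : ℝ → ℝ} (hE0 : 0 ≤ E 0)
    (hE : ContinuousOn E (Icc 0 T)) (hd : ∀ s ∈ Ioo 0 T, HasDerivAt E (E' s) s)
    (hle : ∀ s ∈ Ioo 0 T, E' s ≤ c * (E s + m)) {s : ℝ} (hs : s ∈ Icc 0 T) :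
    E s ≤ Real.exp (c * T) * (E 0 + m) := by
  have hder : ∀ s ∈ Ioo 0 T, HasDerivAt (fun s => (E s + m) * Real.exp (-(c * s)))
      ((E' s - c * (E s + m)) * Real.exp (-(c * s))) s := by
    intro s hs
    have h1 : HasDerivAt (fun s => Real.exp (-(c * s))) (Real.exp (-(c * s)) * (-(c * 1))) s :=
      (((hasDerivAt_id s).const_mul c).neg).exp
    have := ((hd s hs).add_const m).mul h1
    refine this.congr_deriv ?_
    ring
  have hanti : AntitoneOn (fun s => (E s + m) * Real.exp (-(c * s))) (Icc 0 T) := by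
    refine antitoneOn_of_deriv_nonpos (convex_Icc 0 T) ?_ ?_ ?_
    · exact (hE.add continuousOn_const).mul (by fun_prop)
    · rw [interior_Icc]
      exact fun s hs => (hder s hs).differentiableAt.differentiableWithinAt
    · rw [interior_Icc]
      intro s hs
      rw [(hder s hs).deriv]
      exact mul_nonpos_of_nonpos_of_nonneg (by linarith [hle s hs]) (Real.exp_pos _).le
  have h1 := hanti ⟨le_rfl, hs.1.trans hs.2⟩ hs hs.1
  simp only [mul_zero, neg_zero, Real.exp_zero, mul_one] at h1
  rw [Real.exp_neg, ← div_eq_mul_inv, div_le_iff₀ (Real.exp_pos _)] at h1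
  have h2 : Real.exp (c * s) ≤ Real.exp (c * T) :=
    Real.exp_le_exp.2 (mul_le_mul_of_nonneg_left hs.2 hc)
  have h3 := mul_le_mul_of_nonneg_left h2 (add_nonneg hE0 hm)
  linarith

/-! ### The error energy -/

/-- The squared `L²` distance between a function and a broken polynomial, cell by cell. -/
def Mesh.distSq {yL yR : ℝ} {M : Mesh yL yR} (f : ℝ → ℝ) (v : M.Broken) : ℝ :=
  ∑ j, ∫ y in M.left j..M.right j, (f y - (v j).eval y) ^ 2

section Energy

variable {yL yR T : ℝ} {M : Mesh yL yR} {k : ℕ}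

theorem continuousOn_slice {a b : ℝ} {g : ℝ → ℝ → ℝ}
    (hg : ContinuousOn (Function.uncurry g) (Icc a b ×ˢ Icc 0 T)) {s : ℝ} (hs : s ∈ Icc 0 T) :
    ContinuousOn (fun y => g y s) (Icc a b) :=
  hg.comp (f := fun y : ℝ => (y, s)) (by fun_prop) fun _ hy => mk_mem_prod hy hs

namespace Mesh

theorem distSq_nonneg (f : ℝ → ℝ) (v : M.Broken) : 0 ≤ distSq f v :=
  Finset.sum_nonneg fun j _ =>
    intervalIntegral.integral_nonneg (M.left_lt_right j).le fun _ _ => sq_nonneg _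

theorem intervalIntegrable_sq_sub {f : ℝ → ℝ} (hf : ContinuousOn f (Icc yL yR)) (v : M.Broken)
    (j : Fin M.N) : IntervalIntegrable (fun y => (f y - (v j).eval y) ^ 2)
      MeasureTheory.volume (M.left j) (M.right j) :=
  ContinuousOn.intervalIntegrable_of_Icc (M.left_lt_right j).le
    (((hf.mono (M.cell_subset j)).sub (v j).continuous.continuousOn).pow 2)

/-- Applied with one of `f`, `g` equal to zero, it passes between the error energy and the conserved
`H₁` functional. -/
theorem distSq_triangle {f g : ℝ → ℝ} (hf : ContinuousOn f (Icc yL yR))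
    (hg : ContinuousOn g (Icc yL yR)) {A : ℝ} (hA : ∀ y ∈ Icc yL yR, |f y - g y| ≤ A)
    (v : M.Broken) : distSq f v ≤ 2 * A ^ 2 * (yR - yL) + 2 * distSq g v := by
  rw [← sum_lengths (M := M), distSq, distSq, Finset.mul_sum, Finset.mul_sum,
    ← Finset.sum_add_distrib]
  refine Finset.sum_le_sum fun j _ => ?_
  have h1 : ∫ y in M.left j..M.right j, (f y - (v j).eval y) ^ 2
      ≤ ∫ y in M.left j..M.right j, (2 * A ^ 2 + 2 * (g y - (v j).eval y) ^ 2) := by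
    refine intervalIntegral.integral_mono_on (M.left_lt_right j).le
      (intervalIntegrable_sq_sub hf v j)
      (intervalIntegrable_const.add ((intervalIntegrable_sq_sub hg v j).const_mul 2))
      fun y hy => ?_
    have h2 := hA y (M.cell_subset j hy)
    have h3 : (f y - g y) ^ 2 ≤ A ^ 2 := sq_le_sq' (neg_le_of_abs_le h2) (le_of_abs_le h2)
    nlinarith [sq_nonneg (f y - g y - (g y - (v j).eval y))]
  refine h1.trans_eq ?_
  rw [intervalIntegral.integral_add intervalIntegrable_const
    ((intervalIntegrable_sq_sub hg v j).const_mul 2), intervalIntegral.integral_const,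
    intervalIntegral.integral_const_mul, smul_eq_mul]
  ring

theorem sq_integral_abs_sub_toFun_le {g : ℝ → ℝ} (hI : yL < yR)
    (hg : ContinuousOn g (Icc yL yR)) (z : M.Broken) :
    (∫ y in yL..yR, |g y - z.toFun y|) ^ 2 ≤ (yR - yL) * distSq g z := by
  have h2 : IntervalIntegrable (fun y => (g y - z.toFun y) ^ 2) MeasureTheory.volume yL yR :=
    intervalIntegrable_of_cells fun j => intervalIntegrable_toFun z j
      (fun y w => (g y - w) ^ 2)
      (((hg.mono (M.cell_subset j)).sub (z j).continuous.continuousOn).pow 2)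
  have := sq_integral_abs_le hI (intervalIntegrable_abs_sub_toFun hg z) h2
  rw [distSq, ← l2norm_sub_toFun_sq hg z]
  unfold l2norm
  rwa [Real.sq_sqrt (intervalIntegral.integral_nonneg hI.le fun y _ => sq_nonneg _)]

theorem continuousOn_distSq (hT : 0 ≤ T) {f : ℝ → ℝ → ℝ}
    (hf : ContinuousOn (Function.uncurry f) (Icc yL yR ×ˢ Icc 0 T)) {v : ℝ → M.Broken}
    (hv : ∀ s ∈ Icc 0 T, v s ∈ M.dgSpace k)
    (hd : ∀ j y, DifferentiableOn ℝ (fun s => (v s j).eval y) (Icc 0 T)) :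
    ContinuousOn (fun s => distSq (fun y => f y s) (v s)) (Icc 0 T) :=
  continuousOn_finsetSum _ fun j _ =>
    continuousOn_parametric_integral (M.left_lt_right j).le hT
      (((hf.mono (prod_mono (M.cell_subset j) subset_rfl)).sub
        (continuousOn_uncurry_eval (fun s hs => hv s hs j) (hd j) _)).pow 2)

theorem hasDerivAt_distSq {f f' : ℝ → ℝ → ℝ}
    (hf : ContinuousOn (Function.uncurry f) (Icc yL yR ×ˢ Icc 0 T))
    (hf' : ContinuousOn (Function.uncurry f') (Icc yL yR ×ˢ Icc 0 T))
    (hff' : ∀ y ∈ Icc yL yR, ∀ s ∈ Icc 0 T, HasDerivWithinAt (f y) (f' y s) (Icc 0 T) s)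
    {v : ℝ → M.Broken} (hv : ∀ s ∈ Icc 0 T, v s ∈ M.dgSpace k)
    (hd : ∀ j y, DifferentiableOn ℝ (fun s => (v s j).eval y) (Icc 0 T)) {s : ℝ}
    (hs : s ∈ Ioo 0 T) {D : M.Broken}
    (hD : ∀ j y, HasDerivWithinAt (fun τ => (v τ j).eval y) ((D j).eval y) (Icc 0 T) s) :
    HasDerivAt (fun τ => distSq (fun y => f y τ) (v τ))
      (∑ j, ∫ y in M.left j..M.right j,
        2 * (f y s - (v s j).eval y) * (f' y s - (D j).eval y)) s :=
  HasDerivAt.fun_sum fun j _ => hasDerivAt_integral_sq (M.left_lt_right j).le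
    (hf.mono (prod_mono (M.cell_subset j) subset_rfl))
    (hf'.mono (prod_mono (M.cell_subset j) subset_rfl))
    (fun y hy => hff' y (M.cell_subset j hy)) (fun s hs => hv s hs j) (hd j) hs (hD j)

end Mesh

/-- The energy estimate on one cell. -/
theorem cell_energy_le {a b : ℝ} (hab : a ≤ b) {u ρ ω : ℝ → ℝ} (hu : ContinuousOn u (Icc a b))
    (hρ : ContinuousOn ρ (Icc a b)) (hω : ContinuousOn ω (Icc a b))
    {uh ρh ωh Dρ Dω π₁ π₂ v₁ v₂ : ℝ[X]} (hρh : ρh.natDegree ≤ k) (hωh : ωh.natDegree ≤ k)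
    (hDρ : Dρ.natDegree ≤ k) (hDω : Dω.natDegree ≤ k) (hπ₁ : π₁.natDegree ≤ k)
    (hπ₂ : π₂.natDegree ≤ k) (hv₁ : v₁.natDegree ≤ k) (hv₂ : v₂.natDegree ≤ k)
    (res₁ : ∀ φ : ℝ[X], φ.natDegree ≤ k →
      ∫ y in a..b, (Dρ.eval y + uh.eval y * ωh.eval y) * φ.eval y = 0)
    (res₂ : ∀ φ : ℝ[X], φ.natDegree ≤ k →
      ∫ y in a..b, (Dω.eval y - ρh.eval y * uh.eval y) * φ.eval y = 0)
    {A B δ κ : ℝ} (hAρ : ∀ y ∈ Icc a b, |ρ y| ≤ A) (hAω : ∀ y ∈ Icc a b, |ω y| ≤ A)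
    (hB : ∀ y ∈ Icc a b, |uh.eval y| ≤ B) (hδ : ∀ y ∈ Icc a b, |u y - uh.eval y| ≤ δ)
    (h₁ : ∀ y ∈ Icc a b, |ρ y - π₁.eval y| ≤ κ) (h₂ : ∀ y ∈ Icc a b, |ω y - π₂.eval y| ≤ κ)
    (h₃ : ∀ y ∈ Icc a b, |u y * ω y - v₁.eval y| ≤ κ)
    (h₄ : ∀ y ∈ Icc a b, |u y * ρ y - v₂.eval y| ≤ κ) :
    (∫ y in a..b, 2 * (ρ y - ρh.eval y) * (-(u y * ω y) - Dρ.eval y))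
      + (∫ y in a..b, 2 * (ω y - ωh.eval y) * (ρ y * u y - Dω.eval y))
      ≤ (3 * B ^ 2 + 6 * A ^ 2 + 8) * ((∫ y in a..b, (ρ y - ρh.eval y) ^ 2)
        + (∫ y in a..b, (ω y - ωh.eval y) ^ 2) + (δ ^ 2 + κ ^ 2) * (b - a)) := by
  have c : ∀ p : ℝ[X], ContinuousOn (fun y => p.eval y) (Icc a b) := fun p => p.continuousOn
  have i₁ : IntervalIntegrable (fun y => 2 * (ρ y - ρh.eval y) * (-(u y * ω y) - Dρ.eval y))
      MeasureTheory.volume a b := ContinuousOn.intervalIntegrable_of_Icc hab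
    ((continuousOn_const.mul (hρ.sub (c ρh))).mul ((hu.mul hω).neg.sub (c Dρ)))
  have i₂ : IntervalIntegrable (fun y => 2 * (ω y - ωh.eval y) * (ρ y * u y - Dω.eval y))
      MeasureTheory.volume a b := ContinuousOn.intervalIntegrable_of_Icc hab
    ((continuousOn_const.mul (hω.sub (c ωh))).mul ((hρ.mul hu).sub (c Dω)))
  have i₃ : IntervalIntegrable (fun y => (ρ y - ρh.eval y) ^ 2) MeasureTheory.volume a b :=
    ContinuousOn.intervalIntegrable_of_Icc hab ((hρ.sub (c ρh)).pow 2)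
  have i₄ : IntervalIntegrable (fun y => (ω y - ωh.eval y) ^ 2) MeasureTheory.volume a b :=
    ContinuousOn.intervalIntegrable_of_Icc hab ((hω.sub (c ωh)).pow 2)
  -- The test functions dictated by `residual_mul_le`; they are admissible because the time
  -- derivatives also have degree at most `k`.
  set φ₁ : ℝ[X] := C 2 * (ρh - π₁) + C 2 * (Dρ + v₁) with hφ₁
  set φ₂ : ℝ[X] := C 2 * (ωh - π₂) + C 2 * (Dω - v₂) with hφ₂
  have dφ₁ : φ₁.natDegree ≤ k := natDegree_add_le_of_degree_le
    ((natDegree_C_mul_le _ _).trans (natDegree_sub_le_of_le hρh hπ₁ |>.trans (max_self k).le))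
    ((natDegree_C_mul_le _ _).trans (natDegree_add_le_of_degree_le hDρ hv₁))
  have dφ₂ : φ₂.natDegree ≤ k := natDegree_add_le_of_degree_le
    ((natDegree_C_mul_le _ _).trans (natDegree_sub_le_of_le hωh hπ₂ |>.trans (max_self k).le))
    ((natDegree_C_mul_le _ _).trans (natDegree_sub_le_of_le hDω hv₂ |>.trans (max_self k).le))
  have j₁ : IntervalIntegrable (fun y => (Dρ.eval y + uh.eval y * ωh.eval y) * φ₁.eval y)
    MeasureTheory.volume a b := Continuous.intervalIntegrable (by fun_prop) _ _
  have j₂ : IntervalIntegrable (fun y => (Dω.eval y - ρh.eval y * uh.eval y) * φ₂.eval y)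
    MeasureTheory.volume a b := Continuous.intervalIntegrable (by fun_prop) _ _
  have i₅ := ((i₃.add i₄).add (intervalIntegrable_const (μ := MeasureTheory.volume)
    (c := δ ^ 2 + κ ^ 2))).const_mul (3 * B ^ 2 + 6 * A ^ 2 + 8)
  have key := intervalIntegral.integral_mono_on hab (i₁.add i₂) ((j₁.add j₂).add i₅)
    fun y hy => by
      have := energy_integrand_le (ρh := ρh.eval y) (ωh := ωh.eval y) (Dρ := Dρ.eval y)
        (Dω := Dω.eval y) (hAρ y hy) (hAω y hy) (hB y hy) (hδ y hy) (h₁ y hy) (h₂ y hy)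
        (h₃ y hy) (h₄ y hy)
      simpa [hφ₁, hφ₂] using this
  rw [intervalIntegral.integral_add i₁ i₂, intervalIntegral.integral_add (j₁.add j₂) i₅,
    intervalIntegral.integral_add j₁ j₂, res₁ φ₁ dφ₁, res₂ φ₂ dφ₂,
    intervalIntegral.integral_const_mul,
    intervalIntegral.integral_add (i₃.add i₄) intervalIntegrable_const,
    intervalIntegral.integral_add i₃ i₄, intervalIntegral.integral_const, smul_eq_mul] at key
  linarith

section Scheme

variable {gR : ℝ → ℝ} {uh ρh ωh : ℝ → M.Broken}

/-- The time derivatives of a discrete solution, as broken polynomials, with the Galerkin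
orthogonality of the residuals. -/
theorem IsDGSolution.exists_derivatives (hT : 0 < T) (h : IsDGSolution M k T gR uh ρh ωh) {s : ℝ}
    (hs : s ∈ Icc 0 T) : ∃ Dρ ∈ M.dgSpace k, ∃ Dω ∈ M.dgSpace k,
      (∀ j y, HasDerivWithinAt (fun τ => (ρh τ j).eval y) ((Dρ j).eval y) (Icc 0 T) s) ∧
      (∀ j y, HasDerivWithinAt (fun τ => (ωh τ j).eval y) ((Dω j).eval y) (Icc 0 T) s) ∧
      (∀ j, ∀ φ : ℝ[X], φ.natDegree ≤ k → ∫ y in M.left j..M.right j,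
        ((Dρ j).eval y + (uh s j).eval y * (ωh s j).eval y) * φ.eval y = 0) ∧
      (∀ j, ∀ φ : ℝ[X], φ.natDegree ≤ k → ∫ y in M.left j..M.right j,
        ((Dω j).eval y - (ρh s j).eval y * (uh s j).eval y) * φ.eval y = 0) := by
  choose Dρ hDρ hρ using fun j =>
    exists_derivative_polynomial (fun s hs => h.mem_ρ s hs j) (h.diff_ρ j) hs
  choose Dω hDω hω using fun j =>
    exists_derivative_polynomial (fun s hs => h.mem_ω s hs j) (h.diff_ω j) hs
  have hU := uniqueDiffOn_Icc hT s hs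
  refine ⟨Dρ, hDρ, Dω, hDω, hρ, hω, fun j φ hφ => ?_, fun j φ hφ => ?_⟩
  · have := h.eq_ρ s hs (fun _ => φ) (fun _ => hφ) j
    simp only [Mesh.timeDeriv, (hρ j _).derivWithin hU] at this
    simp only [add_mul]
    rwa [intervalIntegral.integral_add (Continuous.intervalIntegrable (by fun_prop) _ _)
      (Continuous.intervalIntegrable (by fun_prop) _ _)]
  · have := h.eq_ω s hs (fun _ => φ) (fun _ => hφ) j
    simp only [Mesh.timeDeriv, (hω j _).derivWithin hU] at this
    simp only [sub_mul]
    rw [intervalIntegral.integral_sub (Continuous.intervalIntegrable (by fun_prop) _ _)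
      (Continuous.intervalIntegrable (by fun_prop) _ _), this, sub_self]

/-- The `H₁` functional of a discrete solution does not exceed its initial value. -/
theorem IsDGSolution.energy_le_initial (hT : 0 < T) (h : IsDGSolution M k T gR uh ρh ωh) {s : ℝ}
    (hs : s ∈ Icc 0 T) :
    Mesh.distSq (fun _ => 0) (ρh s) + Mesh.distSq (fun _ => 0) (ωh s)
      ≤ Mesh.distSq (fun _ => 0) (ρh 0) + Mesh.distSq (fun _ => 0) (ωh 0) := by
  have hc : ContinuousOn (Function.uncurry fun _ _ : ℝ => (0 : ℝ)) (Icc yL yR ×ˢ Icc 0 T) :=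
    continuousOn_const
  have hder : ∀ s ∈ Ioo 0 T, HasDerivAt (fun s => Mesh.distSq (fun _ => 0) (ρh s)
      + Mesh.distSq (fun _ => 0) (ωh s)) 0 s := by
    intro s hs
    obtain ⟨Dρ, -, Dω, -, hρ, hω, r₁, r₂⟩ := h.exists_derivatives hT (Ioo_subset_Icc_self hs)
    have h0 : ∀ y ∈ Icc yL yR, ∀ s ∈ Icc 0 T,
        HasDerivWithinAt (fun _ : ℝ => (0 : ℝ)) 0 (Icc 0 T) s :=
      fun y _ s _ => hasDerivWithinAt_const s _ 0
    refine ((Mesh.hasDerivAt_distSq hc hc h0 h.mem_ρ h.diff_ρ hs hρ).add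
      (Mesh.hasDerivAt_distSq hc hc h0 h.mem_ω h.diff_ω hs hω)).congr_deriv ?_
    rw [← Finset.sum_add_distrib]
    refine Finset.sum_eq_zero fun j _ => ?_
    have e₁ := r₁ j (ρh s j) (h.mem_ρ s (Ioo_subset_Icc_self hs) j)
    have e₂ := r₂ j (ωh s j) (h.mem_ω s (Ioo_subset_Icc_self hs) j)
    -- Tested with `ρh` and `ωh`, the two residuals contribute opposite cubic terms `uh ωh ρh`, so
    -- the derivative is zero.
    rw [← intervalIntegral.integral_add (Continuous.intervalIntegrable (by fun_prop) _ _)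
      (Continuous.intervalIntegrable (by fun_prop) _ _)]
    have e₃ : ∀ y : ℝ, 2 * (0 - (ρh s j).eval y) * (0 - (Dρ j).eval y)
        + 2 * (0 - (ωh s j).eval y) * (0 - (Dω j).eval y)
        = 2 * (((Dρ j).eval y + (uh s j).eval y * (ωh s j).eval y) * (ρh s j).eval y)
        + 2 * (((Dω j).eval y - (ρh s j).eval y * (uh s j).eval y) * (ωh s j).eval y) :=
      fun y => by ring
    simp_rw [e₃]
    rw [intervalIntegral.integral_add (Continuous.intervalIntegrable (by fun_prop) _ _)
      (Continuous.intervalIntegrable (by fun_prop) _ _), intervalIntegral.integral_const_mul,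
      intervalIntegral.integral_const_mul, e₁, e₂]
    ring
  have := gronwall_le (c := 0) (m := 0) (E' := fun _ => 0)
    (E := fun s => Mesh.distSq (fun _ => 0) (ρh s) + Mesh.distSq (fun _ => 0) (ωh s))
    le_rfl le_rfl
    (add_nonneg (Mesh.distSq_nonneg _ _) (Mesh.distSq_nonneg _ _))
    ((Mesh.continuousOn_distSq hT.le hc h.mem_ρ h.diff_ρ).add
      (Mesh.continuousOn_distSq hT.le hc h.mem_ω h.diff_ω)) hder (fun s _ => by simp) hs
  simpa using this

end Scheme

end Energy

/-- Allowing every `K' ≥ K` lets a single constant serve for several functions at once. -/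
theorem exists_mesh_approx {yL yR T : ℝ} (hI : yL < yR) (hT : 0 < T) (k : ℕ) {f : ℝ → ℝ → ℝ}
    (hf : ContDiffOn ℝ ((⊤ : ℕ∞) : WithTop ℕ∞) (Function.uncurry f) (Icc yL yR ×ˢ Icc 0 T)) :
    ∃ K : ℝ, 0 < K ∧ ∀ K' : ℝ, K ≤ K' → ∀ (M : Mesh yL yR) (j : Fin M.N), ∀ s ∈ Icc 0 T,
      ∃ p : ℝ[X], p.natDegree ≤ k ∧
        ∀ y ∈ Icc (M.left j) (M.right j), |f y s - p.eval y| ≤ K' * M.size ^ (k + 1) := by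
  obtain ⟨K, hK, h⟩ := exists_approx_degree_lt hI hT (k + 1) f hf
  refine ⟨K, hK, fun K' hK' M j s hs => ?_⟩
  obtain ⟨p, hp, hpa⟩ := h s hs _ _ (M.left_lt_right j) (M.cell_subset j)
  refine ⟨p, natDegree_le_of_degree_lt hp, fun y hy => (hpa y hy).trans ?_⟩
  have h1 := M.right_sub_left_le_size j
  have h2 := sub_pos.2 (M.left_lt_right j)
  have h3 := hK.le.trans hK'
  gcongr

/-! ### The error estimate -/

section Estimate

variable {yL yR T : ℝ} {gL gR : ℝ → ℝ} {u ρ ω : ℝ → ℝ → ℝ} {M : Mesh yL yR} {k : ℕ}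
  {uh ρh ωh : ℝ → M.Broken}

/-- The energy of the errors in `ρ` and `ω`. -/
def errorEnergy (ρ ω : ℝ → ℝ → ℝ) (ρh ωh : ℝ → M.Broken) (s : ℝ) : ℝ :=
  Mesh.distSq (fun y => ρ y s) (ρh s) + Mesh.distSq (fun y => ω y s) (ωh s)

theorem errorEnergy_nonneg (ρ ω : ℝ → ℝ → ℝ) (ρh ωh : ℝ → M.Broken) (s : ℝ) :
    0 ≤ errorEnergy ρ ω ρh ωh s :=
  add_nonneg (Mesh.distSq_nonneg _ _) (Mesh.distSq_nonneg _ _)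

theorem exists_errorEnergy_derivative_le (hT : 0 < T)
    (hsol : IsSmoothCDSolution yL yR T gL gR u ρ ω) (h : IsDGSolution M k T gR uh ρh ωh)
    {A B δ κ s : ℝ} (hs : s ∈ Ioo 0 T) (hAρ : ∀ y ∈ Icc yL yR, |ρ y s| ≤ A)
    (hAω : ∀ y ∈ Icc yL yR, |ω y s| ≤ A)
    (hB : ∀ j, ∀ y ∈ Icc (M.left j) (M.right j), |(uh s j).eval y| ≤ B)
    (hδ : ∀ j, ∀ y ∈ Icc (M.left j) (M.right j), |u y s - (uh s j).eval y| ≤ δ)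
    (h₁ : ∀ j, ∃ p : ℝ[X], p.natDegree ≤ k ∧
      ∀ y ∈ Icc (M.left j) (M.right j), |ρ y s - p.eval y| ≤ κ)
    (h₂ : ∀ j, ∃ p : ℝ[X], p.natDegree ≤ k ∧
      ∀ y ∈ Icc (M.left j) (M.right j), |ω y s - p.eval y| ≤ κ)
    (h₃ : ∀ j, ∃ p : ℝ[X], p.natDegree ≤ k ∧
      ∀ y ∈ Icc (M.left j) (M.right j), |u y s * ω y s - p.eval y| ≤ κ)
    (h₄ : ∀ j, ∃ p : ℝ[X], p.natDegree ≤ k ∧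
      ∀ y ∈ Icc (M.left j) (M.right j), |u y s * ρ y s - p.eval y| ≤ κ) :
    ∃ E', HasDerivAt (errorEnergy ρ ω ρh ωh) E' s ∧
      E' ≤ (3 * B ^ 2 + 6 * A ^ 2 + 8) *
        (errorEnergy ρ ω ρh ωh s + (δ ^ 2 + κ ^ 2) * (yR - yL)) := by
  have hsI := Ioo_subset_Icc_self hs
  obtain ⟨Dρ, mρ, Dω, mω, dρ, dω, r₁, r₂⟩ := h.exists_derivatives hT hsI
  have cu := hsol.smooth_u.continuousOn
  have cρ := hsol.smooth_ρ.continuousOn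
  have cω := hsol.smooth_ω.continuousOn
  refine ⟨_, (Mesh.hasDerivAt_distSq (f' := fun y s => -(u y s * ω y s)) cρ (cu.mul cω).neg
    hsol.eq_ρ h.mem_ρ h.diff_ρ hs dρ).add
    (Mesh.hasDerivAt_distSq (f' := fun y s => ρ y s * u y s) cω (cρ.mul cu)
      hsol.eq_ω h.mem_ω h.diff_ω hs dω), ?_⟩
  rw [← Mesh.sum_lengths (M := M), errorEnergy, Mesh.distSq, Mesh.distSq, Finset.mul_sum,
    ← Finset.sum_add_distrib, ← Finset.sum_add_distrib, ← Finset.sum_add_distrib,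
    Finset.mul_sum]
  refine Finset.sum_le_sum fun j _ => ?_
  obtain ⟨π₁, dπ₁, b₁⟩ := h₁ j
  obtain ⟨π₂, dπ₂, b₂⟩ := h₂ j
  obtain ⟨v₁, dv₁, b₃⟩ := h₃ j
  obtain ⟨v₂, dv₂, b₄⟩ := h₄ j
  have hsub := M.cell_subset j
  exact cell_energy_le (M.left_lt_right j).le ((continuousOn_slice cu hsI).mono hsub)
    ((continuousOn_slice cρ hsI).mono hsub) ((continuousOn_slice cω hsI).mono hsub)
    (h.mem_ρ s hsI j) (h.mem_ω s hsI j) (mρ j) (mω j) dπ₁ dπ₂ dv₁ dv₂ (r₁ j) (r₂ j)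
    (fun y hy => hAρ y (hsub hy)) (fun y hy => hAω y (hsub hy)) (hB j) (hδ j) b₁ b₂ b₃ b₄

/-- A bound for the error energy from the conservation of the `H₁` functional. -/
theorem errorEnergy_le_initial (hT : 0 < T)
    (hsol : IsSmoothCDSolution yL yR T gL gR u ρ ω) (h : IsDGSolution M k T gR uh ρh ωh)
    {A : ℝ} (hAρ : ∀ y ∈ Icc yL yR, ∀ s ∈ Icc 0 T, |ρ y s| ≤ A)
    (hAω : ∀ y ∈ Icc yL yR, ∀ s ∈ Icc 0 T, |ω y s| ≤ A) {s : ℝ} (hs : s ∈ Icc 0 T) :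
    errorEnergy ρ ω ρh ωh s
      ≤ 12 * A ^ 2 * (yR - yL) + 4 * errorEnergy ρ ω ρh ωh 0 := by
  have h0 : (0 : ℝ) ∈ Icc 0 T := ⟨le_rfl, hT.le⟩
  have c0 : ContinuousOn (fun _ : ℝ => (0 : ℝ)) (Icc yL yR) := continuousOn_const
  have cρ := fun s hs => continuousOn_slice hsol.smooth_ρ.continuousOn (s := s) hs
  have cω := fun s hs => continuousOn_slice hsol.smooth_ω.continuousOn (s := s) hs
  have e₁ := Mesh.distSq_triangle (A := A) (cρ s hs) c0
    (fun y hy => by simpa using hAρ y hy s hs) (ρh s)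
  have e₂ := Mesh.distSq_triangle (A := A) (cω s hs) c0
    (fun y hy => by simpa using hAω y hy s hs) (ωh s)
  have e₃ := Mesh.distSq_triangle (A := A) c0 (cρ 0 h0)
    (fun y hy => by simpa using hAρ y hy 0 h0) (ρh 0)
  have e₄ := Mesh.distSq_triangle (A := A) c0 (cω 0 h0)
    (fun y hy => by simpa using hAω y hy 0 h0) (ωh 0)
  -- The path is error at `s`, discrete functional at `s`, the same at `0`, error at `0`. Each of
  -- the two triangle inequalities doubles, giving `4 + 2 · 4 = 12` and `2 · 2 = 4`.
  have e₅ := h.energy_le_initial hT hs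
  simp only [errorEnergy]
  linarith

theorem l2norm_sq {f : ℝ → ℝ → ℝ}
    (hf : ContDiffOn ℝ ((⊤ : ℕ∞) : WithTop ℕ∞) (Function.uncurry f) (Icc yL yR ×ˢ Icc 0 T))
    {s : ℝ} (hs : s ∈ Icc 0 T) (v : M.Broken) :
    l2norm yL yR (fun y => f y s - v.toFun y) ^ 2 = Mesh.distSq (fun y => f y s) v :=
  Mesh.l2norm_sub_toFun_sq (continuousOn_slice hf.continuousOn hs) v

theorem distSq_le_of_abs_le {f : ℝ → ℝ} (hf : ContinuousOn f (Icc yL yR)) {v : M.Broken} {δ : ℝ}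
    (hδ : ∀ j, ∀ y ∈ Icc (M.left j) (M.right j), |f y - (v j).eval y| ≤ δ) :
    Mesh.distSq f v ≤ δ ^ 2 * (yR - yL) := by
  rw [← Mesh.sum_lengths (M := M), Mesh.distSq, Finset.mul_sum]
  refine Finset.sum_le_sum fun j _ => ?_
  refine (intervalIntegral.integral_mono_on (M.left_lt_right j).le
    (Mesh.intervalIntegrable_sq_sub hf v j) (intervalIntegrable_const (c := δ ^ 2))
    fun y hy => ?_).trans_eq ?_
  · exact sq_le_sq' (neg_le_of_abs_le (hδ j y hy)) (le_of_abs_le (hδ j y hy))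
  · rw [intervalIntegral.integral_const, smul_eq_mul, mul_comm]

theorem le_sqrt_mul {x Q H : ℝ} (hH : 0 ≤ H) (h : x ^ 2 ≤ Q * H ^ 2) : x ≤ Real.sqrt Q * H := by
  rw [← Real.sqrt_sq hH, ← Real.sqrt_mul' Q (sq_nonneg H)]
  exact Real.le_sqrt_of_sq_le h

theorem sq_add_mul_le {K κ W S : ℝ} (hW : W ^ 2 ≤ S) :
    ((1 + K) * κ + K * W) ^ 2 ≤ 2 * (1 + K) ^ 2 * κ ^ 2 + 2 * K ^ 2 * S := by
  have := mul_le_mul_of_nonneg_left hW (sq_nonneg K)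
  nlinarith [sq_nonneg ((1 + K) * κ - K * W)]

end Estimate

end ShortPulse

end

/-! ### Choice of constants and conclusion. -/

theorem mainTheorem1 (yL yR T : ℝ) (hI : yL < yR) (hT : 0 < T) (gL gR : ℝ → ℝ)
    (u ρ ω : ℝ → ℝ → ℝ) (hsol : ShortPulse.IsSmoothCDSolution yL yR T gL gR u ρ ω)
    (k : ℕ) (C₀ : ℝ) :
    ∃ C : ℝ, 0 < C ∧
      ∀ (M : ShortPulse.Mesh yL yR) (uh ρh ωh : ℝ → M.Broken),
        ShortPulse.IsDGSolution M k T gR uh ρh ωh →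
        ShortPulse.totalError u ρ ω uh ρh ωh 0 ≤ C₀ * M.size ^ (k + 1) →
        ∀ s ∈ Set.Icc 0 T,
          ShortPulse.totalError u ρ ω uh ρh ωh s ≤ C * M.size ^ (k + 1) := by
  open ShortPulse in
  have su := hsol.smooth_u
  have sρ := hsol.smooth_ρ
  have sω := hsol.smooth_ω
  obtain ⟨A₁, pA₁, hA₁⟩ := exists_bound_of_smooth su
  obtain ⟨A₂, pA₂, hA₂⟩ := exists_bound_of_smooth sρ
  obtain ⟨A₃, pA₃, hA₃⟩ := exists_bound_of_smooth sω
  obtain ⟨K₁, pK₁, hK₁⟩ := exists_mesh_approx hI hT k su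
  obtain ⟨K₂, pK₂, hK₂⟩ := exists_mesh_approx hI hT k sρ
  obtain ⟨K₃, pK₃, hK₃⟩ := exists_mesh_approx hI hT k sω
  obtain ⟨K₄, pK₄, hK₄⟩ := exists_mesh_approx hI hT k (f := fun y s => u y s * ω y s) (su.mul sω)
  obtain ⟨K₅, pK₅, hK₅⟩ := exists_mesh_approx hI hT k (f := fun y s => u y s * ρ y s) (su.mul sρ)
  obtain ⟨K, pK, hK⟩ := exists_antiderivative_error_bound k
  obtain ⟨A, hA⟩ : ∃ x, x = A₁ + A₂ + A₃ := ⟨_, rfl⟩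
  obtain ⟨K₀, hK₀⟩ : ∃ x, x = K₁ + K₂ + K₃ + K₄ + K₅ := ⟨_, rfl⟩
  set ℓ := yR - yL with hℓ
  have pℓ : 0 < ℓ := sub_pos.2 hI
  obtain ⟨Hm, hHm'⟩ : ∃ x, x = ℓ ^ (k + 1) := ⟨_, rfl⟩
  -- `Em` is the a priori bound of the error energy from conservation, with `Hm` bounding `h^(k+1)`;
  -- `B` is the resulting bound for `|u_h|`. Both precede the mesh, so they cannot depend on it.
  obtain ⟨Em, hEm⟩ : ∃ x, x = 12 * A ^ 2 * ℓ + 8 * C₀ ^ 2 * Hm ^ 2 := ⟨_, rfl⟩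
  obtain ⟨B, hB⟩ : ∃ x, x = A + ((1 + K) * (K₀ * Hm) + K * (ℓ * Em + 1)) := ⟨_, rfl⟩
  -- The factor `1 + 2 K² ℓ²` absorbs the part of `δ² ℓ` that is proportional to the error energy;
  -- the rest of `δ²` together with `κ²` becomes the source term of order `h^(2k+2)`.
  obtain ⟨c, hc⟩ : ∃ x, x = (3 * B ^ 2 + 6 * A ^ 2 + 8) * (1 + 2 * K ^ 2 * ℓ ^ 2) := ⟨_, rfl⟩
  obtain ⟨Q, hQ⟩ : ∃ x, x = Real.exp (c * T) * (2 * C₀ ^ 2 + (2 * (1 + K) ^ 2 + 1) * ℓ * K₀ ^ 2) := ⟨_, rfl⟩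
  obtain ⟨Q', hQ'⟩ : ∃ x, x = (2 * (1 + K) ^ 2 * K₀ ^ 2 + 2 * K ^ 2 * (ℓ * Q)) * ℓ := ⟨_, rfl⟩
  have pK₀ : 0 < K₀ := by rw [hK₀]; positivity
  have pc : 0 ≤ c := by rw [hc]; positivity
  refine ⟨Real.sqrt Q' + Real.sqrt Q + Real.sqrt Q + 1, by positivity, ?_⟩
  intro M uh ρh ωh h hinit s hs
  set H := M.size ^ (k + 1) with hH
  have pH : 0 < H := pow_pos M.size_pos _
  have hHm : H ≤ Hm := hHm' ▸ pow_le_pow_left₀ M.size_pos.le M.size_le _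
  have h0 : (0 : ℝ) ∈ Icc 0 T := ⟨le_rfl, hT.le⟩
  set E := errorEnergy ρ ω ρh ωh with hE
  have hE0 : E 0 ≤ 2 * C₀ ^ 2 * H ^ 2 := by
    have n₁ := l2norm_nonneg yL yR (fun y => u y 0 - (uh 0).toFun y)
    have n₂ := l2norm_nonneg yL yR (fun y => ω y 0 - (ωh 0).toFun y)
    have n₃ := l2norm_nonneg yL yR (fun y => ρ y 0 - (ρh 0).toFun y)
    unfold totalError at hinit
    have e₂ := pow_le_pow_left₀ n₂ (show _ ≤ C₀ * H by linarith) 2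
    have e₃ := pow_le_pow_left₀ n₃ (show _ ≤ C₀ * H by linarith) 2
    rw [l2norm_sq sω h0] at e₂
    rw [l2norm_sq sρ h0] at e₃
    rw [mul_pow] at e₂ e₃
    have e₄ : E 0 = Mesh.distSq (fun y => ρ y 0) (ρh 0) + Mesh.distSq (fun y => ω y 0) (ωh 0) := rfl
    linarith
  have hEs : ∀ s ∈ Icc 0 T, E s ≤ Em := by
    intro s hs
    have e₁ := errorEnergy_le_initial hT hsol h (A := A)
      (fun y hy s hs => (hA₂ y hy s hs).trans (by linarith))
      (fun y hy s hs => (hA₃ y hy s hs).trans (by linarith)) hs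
    have e₂ := mul_le_mul_of_nonneg_left (pow_le_pow_left₀ pH.le hHm 2) (sq_nonneg C₀)
    rw [← hℓ] at e₁
    linarith
  set W : ℝ → ℝ := fun s => ∫ y in yL..yR, |ω y s - (ωh s).toFun y| with hW
  have hWE : ∀ s ∈ Icc 0 T, W s ^ 2 ≤ ℓ * E s := by
    intro s hs
    refine (Mesh.sq_integral_abs_sub_toFun_le hI (continuousOn_slice sω.continuousOn hs)
      (ωh s)).trans (mul_le_mul_of_nonneg_left ?_ pℓ.le)
    exact le_add_of_nonneg_left (Mesh.distSq_nonneg _ _)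
  set δ : ℝ → ℝ := fun s => (1 + K) * (K₀ * H) + K * W s with hδ
  have hδu : ∀ s ∈ Icc 0 T, ∀ j, ∀ y ∈ Icc (M.left j) (M.right j),
      |u y s - (uh s j).eval y| ≤ δ s := by
    intro s hs j
    obtain ⟨p, hp, hpa⟩ := hK₁ K₀ (by linarith) M j s hs
    exact hK (f := fun y => u y s) (g := fun y => ω y s) (fun y hy => hsol.eq_u y hy s hs)
      (continuousOn_slice sω.continuousOn hs) (hsol.bdry_right s hs) (h.mem_u s hs)
      (h.eq_u s hs) j p _ hp hpa
  have hδ2 : ∀ s ∈ Icc 0 T,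
      δ s ^ 2 ≤ 2 * (1 + K) ^ 2 * (K₀ * H) ^ 2 + 2 * K ^ 2 * (ℓ * E s) :=
    fun s hs => sq_add_mul_le (hWE s hs)
  have hBu : ∀ s ∈ Icc 0 T, ∀ j, ∀ y ∈ Icc (M.left j) (M.right j),
      |(uh s j).eval y| ≤ B := by
    intro s hs j y hy
    have e₁ := hδu s hs j y hy
    have e₂ := hA₁ y (M.cell_subset j hy) s hs
    have e₃ : W s ≤ ℓ * Em + 1 := by
      have := (hWE s hs).trans (mul_le_mul_of_nonneg_left (hEs s hs) pℓ.le)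
      -- `W ≤ W² + 1` avoids a square root in the definition of `B`.
      nlinarith [sq_nonneg (W s - 1)]
    have e₄ : δ s ≤ (1 + K) * (K₀ * Hm) + K * (ℓ * Em + 1) := by
      simp only [hδ]
      gcongr
    have e₅ : (uh s j).eval y = u y s - (u y s - (uh s j).eval y) := by ring
    rw [e₅]
    refine (abs_sub _ _).trans ?_
    linarith
  have hder : ∀ s ∈ Ioo 0 T, ∃ E', HasDerivAt E E' s ∧
      E' ≤ c * (E s + (2 * (1 + K) ^ 2 + 1) * ℓ * (K₀ * H) ^ 2) := by
    intro s hs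
    have hsI := Ioo_subset_Icc_self hs
    obtain ⟨E', d, hle⟩ := exists_errorEnergy_derivative_le hT hsol h (A := A) (B := B)
      (δ := δ s) (κ := K₀ * H) hs (fun y hy => (hA₂ y hy s hsI).trans (by linarith))
      (fun y hy => (hA₃ y hy s hsI).trans (by linarith)) (hBu s hsI) (hδu s hsI)
      (fun j => hK₂ K₀ (by linarith) M j s hsI) (fun j => hK₃ K₀ (by linarith) M j s hsI)
      (fun j => hK₄ K₀ (by linarith) M j s hsI) (fun j => hK₅ K₀ (by linarith) M j s hsI)
    refine ⟨E', d, hle.trans ?_⟩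
    rw [hc, mul_assoc]
    refine mul_le_mul_of_nonneg_left ?_ (by positivity)
    have e₁ := mul_le_mul_of_nonneg_right (hδ2 s hsI) pℓ.le
    have e₂ : 0 ≤ 2 * K ^ 2 * ℓ ^ 2 * ((2 * (1 + K) ^ 2 + 1) * ℓ * (K₀ * H) ^ 2) := by
      positivity
    rw [← hℓ]
    linarith
  choose! E' hE' hE'le using hder
  have hEc : ContinuousOn E (Icc 0 T) :=
    (Mesh.continuousOn_distSq hT.le sρ.continuousOn h.mem_ρ h.diff_ρ).add
      (Mesh.continuousOn_distSq hT.le sω.continuousOn h.mem_ω h.diff_ω)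
  have hEQ : E s ≤ Q * H ^ 2 := by
    have e₁ := gronwall_le (c := c) pc (by positivity)
      (errorEnergy_nonneg ρ ω ρh ωh 0) hEc hE' hE'le hs
    refine e₁.trans ?_
    rw [hQ, mul_assoc (Real.exp _)]
    refine mul_le_mul_of_nonneg_left ?_ (Real.exp_pos _).le
    linarith
  have hu2 : l2norm yL yR (fun y => u y s - (uh s).toFun y) ^ 2 ≤ Q' * H ^ 2 := by
    rw [l2norm_sq su hs]
    refine (distSq_le_of_abs_le (continuousOn_slice su.continuousOn hs) (hδu s hs)).trans ?_
    have e₁ := mul_le_mul_of_nonneg_left hEQ (show 0 ≤ 2 * K ^ 2 * ℓ by positivity)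
    have e₂ : δ s ^ 2 ≤ (2 * (1 + K) ^ 2 * K₀ ^ 2 + 2 * K ^ 2 * (ℓ * Q)) * H ^ 2 := by
      have := hδ2 s hs
      linarith
    have := mul_le_mul_of_nonneg_right e₂ pℓ.le
    rw [hQ', ← hℓ]
    linarith
  have hω2 : l2norm yL yR (fun y => ω y s - (ωh s).toFun y) ^ 2 ≤ Q * H ^ 2 := by
    rw [l2norm_sq sω hs]
    exact (le_add_of_nonneg_left (Mesh.distSq_nonneg _ _)).trans hEQ
  have hρ2 : l2norm yL yR (fun y => ρ y s - (ρh s).toFun y) ^ 2 ≤ Q * H ^ 2 := by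
    rw [l2norm_sq sρ hs]
    exact (le_add_of_nonneg_right (Mesh.distSq_nonneg _ _)).trans hEQ
  have f₁ := le_sqrt_mul pH.le hu2
  have f₂ := le_sqrt_mul pH.le hω2
  have f₃ := le_sqrt_mul pH.le hρ2
  unfold totalError
  linarith
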